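/- Let $d\in\mathbb N$ and let $\mathcal S(\mathbb R^d)$ be the space of complex-valued rapidly decreasing smooth functions on $\mathbb R^d$, with the seminorms $$\mu_{q,l}(f)=\sup_{x\in\mathbb R^d,\ |\alpha|\le l}(1+|x|)^q\,|\partial^\alpha f(x)|,\qquad (q,l)\in\mathbb N^2 .$$ Define the following spaces of nets $(f_\varepsilon)_\varepsilon\in\mathcal S(\mathbb R^d)^{(0,1]}$: * $\mathcal X_{\mathcal S}(\mathbb R^d)$: there is a map $N:\mathbb N^2\to\mathbb R_+$ with $\mu_{q,l}(f_\varepsilon)=O(\varepsilon^{-N(q,l)})$ as $\varepsilon\to0$ for all $(q,l)\in\mathbb N^2$; * $\mathcal X_{\mathcal S}^\infty(\mathbb R^d)$: the same with a bounded map $N$; * $\mathcal N_{\mathcal S}(\mathbb R^d)$: $\mu_{q,l}(f_\varepsilon)=O(\varepsilon^{m})$ as $\varepsilon\to0$ for all $q,l,m\in\mathbb N$. Let $\mathcal G_{\mathcal S}(\mathbb R^d)=\mathcal X_{\mathcal S}(\mathbb R^d)/\mathcal N_{\mathcal S}(\mathbb R^d)$, write $[\,\cdot\,]_{\mathcal S}$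 for classes in it, and let $\mathcal G^\infty_{\mathcal S}(\mathbb R^d)\subset\mathcal G_{\mathcal S}(\mathbb R^d)$ be the subspace of classes of elements of $\mathcal X^\infty_{\mathcal S}(\mathbb R^d)$. Let $\sigma_{\mathcal S}:\mathcal S(\mathbb R^d)\to\mathcal G_{\mathcal S}(\mathbb R^d)$, $f\mapsto[(f)_\varepsilon]_{\mathcal S}$, be the embedding by constant nets. Let $\mathcal O_C'(\mathbb R^d)\subset\mathcal S'(\mathbb R^d)$ be the space of rapidly decreasing distributions, i.e. the dual of the space $\mathcal O_C(\mathbb R^d)=\bigcup_{k\in\mathbb N}\mathcal S_k$, where $\mathcal S_k$ is the space of the smooth functions all of whose derivatives are $O((1+|x|)^k)$, with its natural seminorms, and $\mathcal O_C(\mathbb R^d)$ carries the locally convex inductive limit topology. Let $\rho\in\mathcal S(\mathbb R^d)$ satisfy $$\int\rho(x)\,dx=1,\qquad \int x^m\rho(x)\,dx=0\quad\text{for all } m\in\mathbb N^d\setminus\{0\},$$ put $\rho_\varepsilon(x)=\varepsilon^{-d}\rho(x/\varepsilon)$, and let $\iota_{\mathcal S}:\mathcal O_C'(\mathbb R^d)\to\mathcal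 G_{\mathcal S}(\mathbb R^d)$, $u\mapsto[(u*\rho_\varepsilon)_\varepsilon]_{\mathcal S}$. Then $\mathcal O_C'(\mathbb R^d)\cap\mathcal G_{\mathcal S}^\infty(\mathbb R^d)=\mathcal S(\mathbb R^d)$, in both of the following senses: 1. inside $\mathcal G_{\mathcal S}(\mathbb R^d)$: $\ \iota_{\mathcal S}\big(\mathcal O_C'(\mathbb R^d)\big)\cap\mathcal G^\infty_{\mathcal S}(\mathbb R^d)=\sigma_{\mathcal S}\big(\mathcal S(\mathbb R^d)\big)$; 2. inside the space of tempered distributions: $\ \{u\in\mathcal O_C'(\mathbb R^d):\iota_{\mathcal S}(u)\in\mathcal G^\infty_{\mathcal S}(\mathbb R^d)\}=\mathcal S(\mathbb R^d)$, where $f\in\mathcal S(\mathbb R^d)$ is identified with the distribution $\varphi\mapsto\int f\varphi\,dx$. -/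

import Mathlib

open scoped SchwartzMap NNReal Topology

namespace RapidlyDecreasing

open MeasureTheory LineDeriv

/-- Euclidean space `ℝ^d`. -/
abbrev E (d : ℕ) : Type := EuclideanSpace ℝ (Fin d)

/-! ### The seminorms `μ_{q,l}` on the Schwartz space -/

/-- `μ_{q,l}(f) = sup { (1 + |x|)^q |D^n f(x)| : x ∈ ℝ^d, n ≤ l }`, where `|D^n f(x)|` is the operator
norm of the `n`-th derivative, which is comparable to the maximum of `|∂^α f(x)|` over `|α| = n`
(with constants that depend only on `n` and `d`). -/
noncomputable def mu {d : ℕ} (q l : ℕ) (f : 𝓢(E d, ℂ)) : ℝ :=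
  ⨆ p : E d × Fin (l + 1), (1 + ‖p.1‖) ^ q * ‖iteratedFDeriv ℝ (p.2 : ℕ) f p.1‖

theorem bddAbove_mu {d : ℕ} (q l : ℕ) (f : 𝓢(E d, ℂ)) :
    BddAbove (Set.range fun p : E d × Fin (l + 1) =>
      (1 + ‖p.1‖) ^ q * ‖iteratedFDeriv ℝ (p.2 : ℕ) f p.1‖) := by
  refine ⟨2 ^ q * ((Finset.Iic (q, l)).sup fun m => SchwartzMap.seminorm ℝ m.1 m.2) f, ?_⟩
  rintro _ ⟨⟨x, n⟩, rfl⟩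
  exact SchwartzMap.one_add_le_sup_seminorm_apply (𝕜 := ℝ) (m := (q, l)) le_rfl
    (Nat.lt_succ_iff.mp n.2) f x

theorem le_mu {d : ℕ} {q l n : ℕ} (hn : n ≤ l) (f : 𝓢(E d, ℂ)) (x : E d) :
    (1 + ‖x‖) ^ q * ‖iteratedFDeriv ℝ n f x‖ ≤ mu q l f :=
  le_ciSup (bddAbove_mu q l f) (x, (⟨n, Nat.lt_succ_iff.mpr hn⟩ : Fin (l + 1)))

theorem mu_le {d : ℕ} {q l : ℕ} {f : 𝓢(E d, ℂ)} {B : ℝ}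
    (h : ∀ n ≤ l, ∀ x, (1 + ‖x‖) ^ q * ‖iteratedFDeriv ℝ n f x‖ ≤ B) : mu q l f ≤ B :=
  ciSup_le fun p => h p.2 (Nat.lt_succ_iff.mp p.2.2) p.1

theorem mu_nonneg {d : ℕ} (q l : ℕ) (f : 𝓢(E d, ℂ)) : 0 ≤ mu q l f :=
  Real.iSup_nonneg fun _ => by positivity

theorem mu_zero {d : ℕ} (q l : ℕ) : mu q l (0 : 𝓢(E d, ℂ)) = 0 := by
  refine le_antisymm (mu_le fun n _ x => ?_) (mu_nonneg _ _ _)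
  have : ((0 : 𝓢(E d, ℂ)) : E d → ℂ) = fun _ => 0 := by ext; rfl
  rw [this, iteratedFDeriv_fun_zero]
  simp

theorem mu_add_le {d : ℕ} (q l : ℕ) (f g : 𝓢(E d, ℂ)) : mu q l (f + g) ≤ mu q l f + mu q l g := by
  refine mu_le fun n hn x => ?_
  have : ((f + g : 𝓢(E d, ℂ)) : E d → ℂ) = (f : E d → ℂ) + g := by ext; rfl
  rw [this, iteratedFDeriv_add_apply (f.smooth n).contDiffAt (g.smooth n).contDiffAt]
  calc _ ≤ (1 + ‖x‖) ^ q * (‖iteratedFDeriv ℝ n f x‖ + ‖iteratedFDeriv ℝ n g x‖) := by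
        gcongr
        exact norm_add_le _ _
    _ ≤ _ := by
        rw [mul_add]
        exact add_le_add (le_mu hn f x) (le_mu hn g x)

theorem mu_smul_le {d : ℕ} (q l : ℕ) (c : ℂ) (f : 𝓢(E d, ℂ)) : mu q l (c • f) ≤ ‖c‖ * mu q l f := by
  refine mu_le fun n hn x => ?_
  have : ((c • f : 𝓢(E d, ℂ)) : E d → ℂ) = c • (f : E d → ℂ) := by ext; rfl
  rw [this, iteratedFDeriv_const_smul_apply (f.smooth n).contDiffAt, norm_smul]
  calc _ = ‖c‖ * ((1 + ‖x‖) ^ q * ‖iteratedFDeriv ℝ n f x‖) := by ring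
    _ ≤ _ := by
        gcongr
        exact le_mu hn f x

/-! ### The spaces `G_S` and `G_S^∞` -/

/-- Nets `(f_ε)_ε` of Schwartz functions, indexed by `ε ∈ (0, 1]`. -/
abbrev Net (d : ℕ) : Type := Set.Ioc (0 : ℝ) 1 → 𝓢(E d, ℂ)

/-- The filter `ε → 0` on `(0, 1]`. -/
def epsToZero : Filter (Set.Ioc (0 : ℝ) 1) := Filter.comap Subtype.val (𝓝[>] (0 : ℝ))

/-- `μ_{q,l}(f_ε) = O(ε^a)` as `ε → 0`. -/
def GrowthBound {d : ℕ} (f : Net d) (q l : ℕ) (a : ℝ) : Prop :=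
  (fun ε => mu q l (f ε)) =O[epsToZero] (fun ε => (ε : ℝ) ^ a)

theorem GrowthBound.zero {d : ℕ} (q l : ℕ) (a : ℝ) : GrowthBound (0 : Net d) q l a := by
  unfold GrowthBound
  simp only [Pi.zero_apply, mu_zero]
  exact Asymptotics.isBigO_zero _ _

theorem GrowthBound.add {d : ℕ} {f g : Net d} {q l : ℕ} {a : ℝ} (hf : GrowthBound f q l a)
    (hg : GrowthBound g q l a) : GrowthBound (f + g) q l a := by
  refine Asymptotics.IsBigO.trans (Asymptotics.isBigO_of_le _ fun ε => ?_)
    (Asymptotics.IsBigO.add hf hg)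
  rw [Real.norm_of_nonneg (mu_nonneg _ _ _),
    Real.norm_of_nonneg (add_nonneg (mu_nonneg _ _ _) (mu_nonneg _ _ _))]
  exact mu_add_le _ _ _ _

theorem GrowthBound.smul {d : ℕ} {f : Net d} {q l : ℕ} {a : ℝ} (c : ℂ)
    (hf : GrowthBound f q l a) : GrowthBound (c • f) q l a := by
  refine Asymptotics.IsBigO.trans (Asymptotics.isBigO_of_le _ fun ε => ?_)
    (Asymptotics.IsBigO.const_mul_left hf ‖c‖)
  rw [Real.norm_of_nonneg (mu_nonneg _ _ _),
    Real.norm_of_nonneg (mul_nonneg (norm_nonneg _) (mu_nonneg _ _ _))]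
  exact mu_smul_le _ _ _ _

theorem GrowthBound.mono {d : ℕ} {f : Net d} {q l : ℕ} {a b : ℝ} (hf : GrowthBound f q l a)
    (hab : b ≤ a) : GrowthBound f q l b := by
  refine Asymptotics.IsBigO.trans hf (Asymptotics.isBigO_of_le _ fun ε => ?_)
  rw [Real.norm_of_nonneg (Real.rpow_nonneg ε.2.1.le _),
    Real.norm_of_nonneg (Real.rpow_nonneg ε.2.1.le _)]
  exact Real.rpow_le_rpow_of_exponent_ge ε.2.1 ε.2.2 hab

/-- Membership in `X_S^{R'}(ℝ^d)` for a set `R'` of maps `ℕ² → ℝ₊`: there is `N ∈ R'` such that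
`μ_{q,l}(f_ε) = O(ε^{-N(q,l)})` for all `(q,l)`. -/
def IsModerate {d : ℕ} (R' : Set (ℕ × ℕ → ℝ≥0)) (f : Net d) : Prop :=
  ∃ N ∈ R', ∀ q l : ℕ, GrowthBound f q l (-(N (q, l) : ℝ))

/-- `R'` is stable by maximum up to a larger element, and nonempty. -/
def MaxStable (R' : Set (ℕ × ℕ → ℝ≥0)) : Prop :=
  R'.Nonempty ∧ ∀ N₁ ∈ R', ∀ N₂ ∈ R', ∃ N ∈ R', ∀ p, max (N₁ p) (N₂ p) ≤ N p

/-- `X_S^{R'}(ℝ^d)` as a vector space. -/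
noncomputable def moderateNets (d : ℕ) (R' : Set (ℕ × ℕ → ℝ≥0)) (hR : MaxStable R') : Submodule ℂ (Net d) where
  carrier := {f | IsModerate R' f}
  zero_mem' := by
    obtain ⟨N, hN⟩ := hR.1
    exact ⟨N, hN, fun q l => GrowthBound.zero q l _⟩
  add_mem' := by
    rintro f g ⟨N₁, h₁, hf⟩ ⟨N₂, h₂, hg⟩
    obtain ⟨N, hN, hmax⟩ := hR.2 N₁ h₁ N₂ h₂
    refine ⟨N, hN, fun q l => ((hf q l).mono ?_).add ((hg q l).mono ?_)⟩
    · exact neg_le_neg (NNReal.coe_le_coe.mpr ((le_max_left _ _).trans (hmax (q, l))))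
    · exact neg_le_neg (NNReal.coe_le_coe.mpr ((le_max_right _ _).trans (hmax (q, l))))
  smul_mem' := by
    rintro c f ⟨N, hN, hf⟩
    exact ⟨N, hN, fun q l => (hf q l).smul c⟩

theorem maxStable_univ : MaxStable Set.univ :=
  ⟨⟨0, trivial⟩, fun N₁ _ N₂ _ => ⟨fun p => max (N₁ p) (N₂ p), trivial, fun _ => le_rfl⟩⟩

/-- The set `B'` of bounded maps `ℕ² → ℝ₊`. -/
def boundedMaps : Set (ℕ × ℕ → ℝ≥0) := {N | BddAbove (Set.range N)}

theorem maxStable_boundedMaps : MaxStable boundedMaps := by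
  refine ⟨⟨0, ⟨0, by rintro _ ⟨p, rfl⟩; exact le_rfl⟩⟩, ?_⟩
  rintro N₁ ⟨b₁, h₁⟩ N₂ ⟨b₂, h₂⟩
  refine ⟨fun p => max (N₁ p) (N₂ p), ⟨max b₁ b₂, ?_⟩, fun _ => le_rfl⟩
  rintro _ ⟨p, rfl⟩
  exact max_le_max (h₁ ⟨p, rfl⟩) (h₂ ⟨p, rfl⟩)

/-- `X_S(ℝ^d)`: the moderate nets. -/
noncomputable def XS (d : ℕ) : Submodule ℂ (Net d) := moderateNets d Set.univ maxStable_univ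

/-- `X_S^∞(ℝ^d)`: the moderate nets with a growth exponent independent of `(q,l)`,
i.e. `R' = B'`. -/
noncomputable def XSInfty (d : ℕ) : Submodule ℂ (Net d) := moderateNets d boundedMaps maxStable_boundedMaps

/-- `N_S(ℝ^d)`: the negligible nets. -/
noncomputable def NS (d : ℕ) : Submodule ℂ (Net d) where
  carrier := {f | ∀ q l m : ℕ, GrowthBound f q l (m : ℝ)}
  zero_mem' := fun q l _ => GrowthBound.zero q l _
  add_mem' := fun hf hg q l m => (hf q l m).add (hg q l m)
  smul_mem' := fun c _ hf q l m => (hf q l m).smul c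

/-- The space `G_S(ℝ^d) = X_S(ℝ^d) / N_S(ℝ^d)` of rapidly decreasing generalized functions. -/
abbrev GS (d : ℕ) : Type := XS d ⧸ (NS d).comap (XS d).subtype

/-- The class `[(f_ε)_ε]_S` of a moderate net. -/
noncomputable def GS.mk {d : ℕ} : XS d →ₗ[ℂ] GS d := ((NS d).comap (XS d).subtype).mkQ

/-- `G_S^∞(ℝ^d)`, as a subspace of `G_S(ℝ^d)`: the classes of nets in `X_S^∞(ℝ^d)`. -/
noncomputable def GSInfty (d : ℕ) : Submodule ℂ (GS d) :=
  ((XSInfty d).comap (XS d).subtype).map GS.mk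

/-- The constant net of a Schwartz function is moderate. -/
theorem const_mem_XS {d : ℕ} (f : 𝓢(E d, ℂ)) : (fun _ => f : Net d) ∈ XS d := by
  refine ⟨0, trivial, fun q l => ?_⟩
  simp only [GrowthBound, Pi.zero_apply, NNReal.coe_zero, neg_zero, Real.rpow_zero]
  exact Asymptotics.isBigO_const_const _ one_ne_zero _

/-- The embedding `σ_S : S(ℝ^d) → G_S(ℝ^d)`, `f ↦ [(f)_ε]_S`. -/
noncomputable def sigmaS {d : ℕ} (f : 𝓢(E d, ℂ)) : GS d := GS.mk ⟨fun _ => f, const_mem_XS f⟩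

/-! ### The space `O_C'` of rapidly decreasing distributions -/

/-- The step `S_k` of `O_C(ℝ^d)`: smooth functions all of whose derivatives are `O((1 + |x|)^k)`. -/
def OCStep (d k : ℕ) : Set (E d → ℂ) :=
  {φ | ContDiff ℝ (⊤ : ℕ∞) φ ∧
    ∀ n : ℕ, ∃ C : ℝ, ∀ x, ‖iteratedFDeriv ℝ n φ x‖ ≤ C * (1 + ‖x‖) ^ k}

theorem OCStep_mono {d k k' : ℕ} (h : k ≤ k') : OCStep d k ⊆ OCStep d k' := by
  rintro φ ⟨hφ, hb⟩
  refine ⟨hφ, fun n => ?_⟩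
  obtain ⟨C, hC⟩ := hb n
  refine ⟨|C|, fun x => (hC x).trans ?_⟩
  have : (1 : ℝ) ≤ 1 + ‖x‖ := by linarith [norm_nonneg x]
  gcongr
  exact le_abs_self C

/-- The space `O_C(ℝ^d)` of very slowly increasing smooth functions, the union of the steps `S_k`. -/
noncomputable def OC (d : ℕ) : Submodule ℂ (E d → ℂ) where
  carrier := {φ | ∃ k, φ ∈ OCStep d k}
  zero_mem' := ⟨0, contDiff_const, fun n => ⟨0, fun x => by
    rw [show (0 : E d → ℂ) = fun _ => 0 from rfl, iteratedFDeriv_fun_zero]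
    simp⟩⟩
  add_mem' := by
    rintro φ ψ ⟨k₁, h₁⟩ ⟨k₂, h₂⟩
    obtain ⟨hφ, hφb⟩ := OCStep_mono (le_max_left k₁ k₂) h₁
    obtain ⟨hψ, hψb⟩ := OCStep_mono (le_max_right k₁ k₂) h₂
    refine ⟨max k₁ k₂, hφ.add hψ, fun n => ?_⟩
    obtain ⟨C₁, hC₁⟩ := hφb n
    obtain ⟨C₂, hC₂⟩ := hψb n
    refine ⟨C₁ + C₂, fun x => ?_⟩
    have hn : ((n : ℕ∞) : WithTop ℕ∞) ≤ ((⊤ : ℕ∞) : WithTop ℕ∞) := by exact_mod_cast le_top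
    rw [iteratedFDeriv_add_apply (hφ.of_le hn).contDiffAt (hψ.of_le hn).contDiffAt, add_mul]
    exact (norm_add_le _ _).trans (add_le_add (hC₁ x) (hC₂ x))
  smul_mem' := by
    rintro c φ ⟨k, hφ, hb⟩
    refine ⟨k, hφ.const_smul c, fun n => ?_⟩
    obtain ⟨C, hC⟩ := hb n
    refine ⟨‖c‖ * C, fun x => ?_⟩
    have hn : ((n : ℕ∞) : WithTop ℕ∞) ≤ ((⊤ : ℕ∞) : WithTop ℕ∞) := by exact_mod_cast le_top
    rw [iteratedFDeriv_const_smul_apply (hφ.of_le hn).contDiffAt, norm_smul, mul_assoc]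
    gcongr
    exact hC x

theorem schwartz_mem_OCStep {d : ℕ} (k : ℕ) (φ : 𝓢(E d, ℂ)) : (φ : E d → ℂ) ∈ OCStep d k := by
  refine OCStep_mono (Nat.zero_le k) ⟨φ.smooth _, fun n => ⟨SchwartzMap.seminorm ℝ 0 n φ, fun x => ?_⟩⟩
  simpa using SchwartzMap.norm_iteratedFDeriv_le_seminorm ℝ φ n x

/-- The inclusion `S(ℝ^d) ⊆ O_C(ℝ^d)`. -/
noncomputable def schwartzToOC {d : ℕ} (φ : 𝓢(E d, ℂ)) : OC d := ⟨φ, 0, schwartz_mem_OCStep 0 φ⟩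

/-- Continuity of a linear form on `O_C(ℝ^d) = ⋃ S_k` for the locally convex inductive limit topology:
the restriction to each step `S_k` is continuous, where `S_k` carries the seminorms
`sup_{x, n ≤ m} (1 + |x|)^{-k} |D^n φ(x)|`, `m ∈ ℕ`. -/
def IsContinuousOnOC {d : ℕ} (L : OC d →ₗ[ℂ] ℂ) : Prop :=
  ∀ k : ℕ, ∃ (m : ℕ) (C : ℝ), ∀ φ : OC d, (φ : E d → ℂ) ∈ OCStep d k → ∀ A : ℝ,
    (∀ n ≤ m, ∀ x, ‖iteratedFDeriv ℝ n (φ : E d → ℂ) x‖ ≤ A * (1 + ‖x‖) ^ k) → ‖L φ‖ ≤ C * A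

/-- The space `O_C'(ℝ^d)` of rapidly decreasing distributions: the dual of `O_C(ℝ^d)`, seen as a space
of tempered distributions by restricting linear forms to `S(ℝ^d)`, which is dense in `O_C(ℝ^d)`. -/
def OCPrime (d : ℕ) : Set 𝓢'(E d, ℂ) :=
  {u | ∃ L : OC d →ₗ[ℂ] ℂ, IsContinuousOnOC L ∧ ∀ φ : 𝓢(E d, ℂ), L (schwartzToOC φ) = u φ}

/-! ### Convolution of a rapidly decreasing distribution with a Schwartz function -/

/-- The Schwartz function `y ↦ φ(x - y)`. -/
noncomputable def reflectAt {d : ℕ} (x : E d) : 𝓢(E d, ℂ) →ₗ[ℂ] 𝓢(E d, ℂ) :=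
  ((SchwartzMap.compSubConstCLM ℂ x).comp
    (SchwartzMap.compCLMOfContinuousLinearEquiv ℂ (ContinuousLinearEquiv.neg ℝ (M := E d)))).toLinearMap

theorem reflectAt_apply {d : ℕ} (x y : E d) (φ : 𝓢(E d, ℂ)) : reflectAt x φ y = φ (x - y) := by
  simp [reflectAt]

/-- The function `(u * φ)(x) = ⟨u, φ(x - ·)⟩`. -/
noncomputable def convFun {d : ℕ} (u : 𝓢'(E d, ℂ)) (φ : 𝓢(E d, ℂ)) (x : E d) : ℂ := u (reflectAt x φ)

theorem norm_iteratedFDeriv_reflectAt {d : ℕ} (n : ℕ) (x y : E d) (φ : 𝓢(E d, ℂ)) :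
    ‖iteratedFDeriv ℝ n (reflectAt x φ) y‖ = ‖iteratedFDeriv ℝ n φ (x - y)‖ := by
  have h : (reflectAt x φ : E d → ℂ) =
      (fun z => φ (x + z)) ∘ (LinearIsometryEquiv.neg ℝ (E := E d)) := by
    ext z
    simp [reflectAt_apply, sub_eq_add_neg]
  rw [h, LinearIsometryEquiv.norm_iteratedFDeriv_comp_right, iteratedFDeriv_comp_add_left]
  simp [sub_eq_add_neg]

/-- The bounds satisfied by the elements of `O_C'` on Schwartz functions. -/
theorem OCPrime.bound {d : ℕ} {u : 𝓢'(E d, ℂ)} (hu : u ∈ OCPrime d) (k : ℕ) :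
    ∃ (m : ℕ) (C : ℝ), 0 ≤ C ∧ ∀ (φ : 𝓢(E d, ℂ)) (A : ℝ), 0 ≤ A →
      (∀ n ≤ m, ∀ x, ‖iteratedFDeriv ℝ n φ x‖ ≤ A * (1 + ‖x‖) ^ k) → ‖u φ‖ ≤ C * A := by
  obtain ⟨L, hL, hLu⟩ := hu
  obtain ⟨m, C, h⟩ := hL k
  refine ⟨m, |C|, abs_nonneg _, fun φ A hA hφ => ?_⟩
  rw [← hLu]
  refine (h (schwartzToOC φ) (schwartz_mem_OCStep k φ) A hφ).trans ?_
  gcongr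
  exact le_abs_self C

theorem convFun_bound {d : ℕ} {u : 𝓢'(E d, ℂ)} (hu : u ∈ OCPrime d) (q : ℕ) :
    ∃ (m : ℕ) (C : ℝ), 0 ≤ C ∧ ∀ (φ : 𝓢(E d, ℂ)) (x : E d),
      (1 + ‖x‖) ^ q * ‖convFun u φ x‖ ≤ C * mu q m φ := by
  obtain ⟨m, C, hC, h⟩ := OCPrime.bound hu q
  refine ⟨m, C, hC, fun φ x => ?_⟩
  have hx : 0 < (1 + ‖x‖) ^ q := by positivity
  have key := h (reflectAt x φ) (mu q m φ / (1 + ‖x‖) ^ q)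
    (div_nonneg (mu_nonneg _ _ _) hx.le) (fun n hn y => ?_)
  · rw [convFun]
    calc _ ≤ (1 + ‖x‖) ^ q * (C * (mu q m φ / (1 + ‖x‖) ^ q)) := by gcongr
      _ = C * mu q m φ := by field_simp
  · rw [norm_iteratedFDeriv_reflectAt, div_mul_eq_mul_div, le_div_iff₀ hx]
    have h1 : 1 + ‖x‖ ≤ (1 + ‖x - y‖) * (1 + ‖y‖) := by
      have : ‖x‖ ≤ ‖x - y‖ + ‖y‖ := by simpa using norm_add_le (x - y) y
      nlinarith [norm_nonneg (x - y), norm_nonneg y, mul_nonneg (norm_nonneg (x - y)) (norm_nonneg y)]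
    calc ‖iteratedFDeriv ℝ n φ (x - y)‖ * (1 + ‖x‖) ^ q
        ≤ ‖iteratedFDeriv ℝ n φ (x - y)‖ * ((1 + ‖x - y‖) * (1 + ‖y‖)) ^ q := by gcongr
      _ = ((1 + ‖x - y‖) ^ q * ‖iteratedFDeriv ℝ n φ (x - y)‖) * (1 + ‖y‖) ^ q := by
          rw [mul_pow]; ring
      _ ≤ mu q m φ * (1 + ‖y‖) ^ q := by
          gcongr
          exact le_mu hn φ (x - y)

/-- Taylor bound, with all derivatives, for the first order remainder `φ(z + h) - φ(z) - Dφ(z) h`. -/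
theorem norm_iteratedFDeriv_remainder_le {V : Type} [NormedAddCommGroup V] [NormedSpace ℝ V]
    (n : ℕ) : ∀ {F : Type} [NormedAddCommGroup F] [NormedSpace ℝ F] (φ : V → F)
    (_ : ContDiff ℝ (⊤ : ℕ∞) φ) (M : ℝ) (_ : ∀ z, ‖iteratedFDeriv ℝ (n + 2) φ z‖ ≤ M) (h z : V),
    ‖iteratedFDeriv ℝ n (fun z => φ (z + h) - φ z - fderiv ℝ φ z h) z‖ ≤ M * ‖h‖ ^ 2 := by
  induction n with
  | zero =>
    intro F _ _ φ hφ M hM h z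
    have hd : Differentiable ℝ φ := hφ.differentiable (by simp)
    have hφ' : ContDiff ℝ (⊤ : ℕ∞) (fderiv ℝ φ) := hφ.fderiv_right (by simp)
    have hd' : Differentiable ℝ (fderiv ℝ φ) := hφ'.differentiable (by simp)
    have hM' : ∀ z, ‖fderiv ℝ (fderiv ℝ φ) z‖ ≤ M := fun z => by
      rw [← norm_iteratedFDeriv_one, norm_iteratedFDeriv_fderiv]
      exact hM z
    have hM0 : 0 ≤ M := (norm_nonneg (fderiv ℝ (fderiv ℝ φ) z)).trans (hM' z)
    rw [norm_iteratedFDeriv_zero]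
    have hseg : ∀ y ∈ Metric.closedBall z ‖h‖, ‖fderiv ℝ φ y - fderiv ℝ φ z‖ ≤ M * ‖h‖ := by
      intro y hy
      have := Convex.norm_image_sub_le_of_norm_fderiv_le (𝕜 := ℝ) (f := fderiv ℝ φ) (s := Set.univ)
        (C := M) (x := z) (y := y) (fun x _ => hd' x) (fun x _ => hM' x) convex_univ trivial trivial
      refine this.trans ?_
      gcongr
      simpa [dist_eq_norm] using hy
    have := Convex.norm_image_sub_le_of_norm_fderiv_le' (𝕜 := ℝ) (f := φ)
      (s := Metric.closedBall z ‖h‖) (φ := fderiv ℝ φ z) (C := M * ‖h‖) (x := z) (y := z + h)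
      (fun x _ => hd x) hseg (convex_closedBall _ _) (by simp) (by simp)
    simp only [add_sub_cancel_left] at this
    calc _ ≤ _ := this
      _ = _ := by ring
  | succ n ih =>
    intro F _ _ φ hφ M hM h z
    have hd : Differentiable ℝ φ := hφ.differentiable (by simp)
    have hφ' : ContDiff ℝ (⊤ : ℕ∞) (fderiv ℝ φ) := hφ.fderiv_right (by simp)
    have hd' : Differentiable ℝ (fderiv ℝ φ) := hφ'.differentiable (by simp)
    have hfd : fderiv ℝ (fun z => φ (z + h) - φ z - fderiv ℝ φ z h) =
        fun z => fderiv ℝ φ (z + h) - fderiv ℝ φ z - fderiv ℝ (fderiv ℝ φ) z h := by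
      ext z w
      have hs : IsSymmSndFDerivAt ℝ φ z :=
        (hφ.contDiffAt).isSymmSndFDerivAt (by
          rw [minSmoothness_of_isRCLikeNormedField]; exact WithTop.coe_le_coe.mpr le_top)
      have h1 : HasFDerivAt (fun z => φ (z + h)) (fderiv ℝ φ (z + h)) z := by
        exact (hasFDerivAt_comp_add_right h).mpr (hd (z + h)).hasFDerivAt
      have h2 := (hd z).hasFDerivAt
      have h3 : HasFDerivAt (fun z => fderiv ℝ φ z h) ((fderiv ℝ (fderiv ℝ φ) z).flip h) z := by
        simpa using (hd' z).hasFDerivAt.clm_apply (hasFDerivAt_const h z)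
      have h4 : fderiv ℝ (fun z => φ (z + h) - φ z - fderiv ℝ φ z h) z = _ :=
        ((h1.sub h2).sub h3).fderiv
      rw [h4]
      simp [hs.eq w h]
    rw [← norm_iteratedFDeriv_fderiv, hfd]
    exact ih (fderiv ℝ φ) hφ' M (fun z => by rw [norm_iteratedFDeriv_fderiv]; exact hM z) h z

/-- The derivative of `u * φ` in the direction `v` is `u * ∂_v φ`. -/
theorem hasFDerivAt_convFun {d : ℕ} {u : 𝓢'(E d, ℂ)} (hu : u ∈ OCPrime d) (φ : 𝓢(E d, ℂ)) (x : E d) :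
    ∃ L : E d →L[ℝ] ℂ, HasFDerivAt (convFun u φ) L x ∧ ∀ v, L v = convFun u (∂_{v} φ) x := by
  let L₀ : E d →ₗ[ℝ] ℂ :=
    { toFun := fun v => convFun u (∂_{v} φ) x
      map_add' := fun v w => by simp only [convFun, lineDerivOp_left_add, map_add]
      map_smul' := fun r v => by
        simp only [convFun, lineDerivOp_left_smul, RingHom.id_apply]
        have : (r • ∂_{v} φ : 𝓢(E d, ℂ)) = (r : ℂ) • ∂_{v} φ := by
          ext y
          simp
        rw [this, map_smul, map_smul]
        simp }
  refine ⟨LinearMap.toContinuousLinearMap L₀, ?_, fun v => rfl⟩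
  obtain ⟨m, C, hC, hb⟩ := OCPrime.bound hu 0
  let M : ℝ := mu 0 (m + 2) φ
  rw [hasFDerivAt_iff_isLittleO_nhds_zero]
  refine Asymptotics.IsBigO.trans_isLittleO (g := fun h : E d => ‖h‖ ^ 2) ?_ ?_
  · refine Asymptotics.IsBigO.of_bound (C * M) (Filter.Eventually.of_forall fun h => ?_)
    have heq : convFun u φ (x + h) - convFun u φ x - LinearMap.toContinuousLinearMap L₀ h =
        u (reflectAt x (SchwartzMap.compSubConstCLM ℂ (-h) φ - φ - ∂_{h} φ)) := by
      have h1 : reflectAt (x + h) φ = reflectAt x (SchwartzMap.compSubConstCLM ℂ (-h) φ) := by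
        ext y
        simp only [reflectAt_apply, SchwartzMap.compSubConstCLM_apply]
        congr 1
        abel
      change u _ - u _ - u _ = _
      rw [h1, map_sub, map_sub, map_sub, map_sub]
    rw [heq]
    have := hb (reflectAt x (SchwartzMap.compSubConstCLM ℂ (-h) φ - φ - ∂_{h} φ)) (M * ‖h‖ ^ 2)
      (mul_nonneg (mu_nonneg _ _ _) (by positivity)) (fun n hn y => ?_)
    · rw [norm_pow, norm_norm, mul_assoc]
      exact this
    · rw [norm_iteratedFDeriv_reflectAt, pow_zero, mul_one]
      have hfun : ((SchwartzMap.compSubConstCLM ℂ (-h) φ - φ - ∂_{h} φ : 𝓢(E d, ℂ)) : E d → ℂ) =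
          fun z => φ (z + h) - φ z - fderiv ℝ φ z h := by
        ext z
        simp [SchwartzMap.lineDerivOp_apply_eq_fderiv]
      rw [hfun]
      refine norm_iteratedFDeriv_remainder_le n φ (φ.smooth _) M (fun z => ?_) h (x - y)
      simpa using le_mu (q := 0) (Nat.add_le_add_right hn 2) φ z
  · have := Asymptotics.isLittleO_norm_pow_id (E' := E d) one_lt_two
    simpa using this

theorem contDiff_convFun_nat {d : ℕ} {u : 𝓢'(E d, ℂ)} (hu : u ∈ OCPrime d) (n : ℕ) :
    ∀ φ : 𝓢(E d, ℂ), ContDiff ℝ n (convFun u φ) := by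
  induction n with
  | zero =>
    intro φ
    refine contDiff_zero.mpr (continuous_iff_continuousAt.mpr fun x => ?_)
    obtain ⟨L, hL, -⟩ := hasFDerivAt_convFun hu φ x
    exact hL.continuousAt
  | succ n ih =>
    intro φ
    rw [Nat.cast_succ, contDiff_succ_iff_fderiv_apply]
    refine ⟨fun x => ?_, fun h => by simp at h, fun v => ?_⟩
    · obtain ⟨L, hL, -⟩ := hasFDerivAt_convFun hu φ x
      exact hL.differentiableAt
    · have : (fun x => fderiv ℝ (convFun u φ) x v) = convFun u (∂_{v} φ) := by
        ext x
        obtain ⟨L, hL, hLv⟩ := hasFDerivAt_convFun hu φ x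
        rw [hL.fderiv, hLv]
      rw [this]
      exact ih _

theorem contDiff_convFun {d : ℕ} {u : 𝓢'(E d, ℂ)} (hu : u ∈ OCPrime d) (φ : 𝓢(E d, ℂ)) :
    ContDiff ℝ (⊤ : ℕ∞) (convFun u φ) :=
  contDiff_infty.mpr fun n => contDiff_convFun_nat hu n φ

theorem mu_lineDeriv_le {d : ℕ} (q l : ℕ) (v : E d) (φ : 𝓢(E d, ℂ)) :
    mu q l (∂_{v} φ) ≤ ‖v‖ * mu q (l + 1) φ := by
  refine mu_le fun n hn x => ?_
  have hφ' : ContDiff ℝ (⊤ : ℕ∞) (fderiv ℝ φ) := (φ.smooth ⊤).fderiv_right (by simp)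
  have h1 : ((∂_{v} φ : 𝓢(E d, ℂ)) : E d → ℂ) = fun z => fderiv ℝ φ z v := by
    ext z
    rfl
  have h2 : ‖iteratedFDeriv ℝ n (∂_{v} φ : 𝓢(E d, ℂ)) x‖ ≤ ‖v‖ * ‖iteratedFDeriv ℝ (n + 1) φ x‖ := by
    rw [h1, ← norm_iteratedFDeriv_fderiv]
    exact norm_iteratedFDeriv_clm_apply_const (N := (⊤ : ℕ∞)) hφ'.contDiffAt
      (by exact_mod_cast le_top)
  calc _ ≤ (1 + ‖x‖) ^ q * (‖v‖ * ‖iteratedFDeriv ℝ (n + 1) φ x‖) := by gcongr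
    _ = ‖v‖ * ((1 + ‖x‖) ^ q * ‖iteratedFDeriv ℝ (n + 1) φ x‖) := by ring
    _ ≤ _ := by
        gcongr
        exact le_mu (Nat.add_le_add_right hn 1) φ x

theorem iteratedFDeriv_convFun_bound {d : ℕ} {u : 𝓢'(E d, ℂ)} (hu : u ∈ OCPrime d) (q m : ℕ) (C : ℝ)
    (hC : 0 ≤ C) (hb : ∀ (φ : 𝓢(E d, ℂ)) (x : E d), (1 + ‖x‖) ^ q * ‖convFun u φ x‖ ≤ C * mu q m φ)
    (n : ℕ) : ∀ (φ : 𝓢(E d, ℂ)) (x : E d) (v : Fin n → E d),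
      (1 + ‖x‖) ^ q * ‖iteratedFDeriv ℝ n (convFun u φ) x v‖ ≤
        C * mu q (m + n) φ * ∏ i, ‖v i‖ := by
  induction n with
  | zero =>
    intro φ x v
    simpa using hb φ x
  | succ n ih =>
    intro φ x v
    have hcd : ContDiff ℝ (⊤ : ℕ∞) (fderiv ℝ (convFun u φ)) :=
      (contDiff_convFun hu φ).fderiv_right (by simp)
    have hfun : (fun x => fderiv ℝ (convFun u φ) x (v (Fin.last n))) =
        convFun u (∂_{v (Fin.last n)} φ) := by
      ext x
      obtain ⟨L, hL, hLv⟩ := hasFDerivAt_convFun hu φ x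
      rw [hL.fderiv, hLv]
    rw [iteratedFDeriv_succ_apply_right, ← iteratedFDeriv_clm_apply_const_apply hcd
      (by exact_mod_cast le_top), hfun, Fin.prod_univ_castSucc]
    refine (ih _ x (Fin.init v)).trans ?_
    have h1 := mu_lineDeriv_le q (m + n) (v (Fin.last n)) φ
    have h2 : 0 ≤ ∏ i, ‖Fin.init v i‖ := Finset.prod_nonneg fun _ _ => norm_nonneg _
    calc C * mu q (m + n) (∂_{v (Fin.last n)} φ) * ∏ i, ‖Fin.init v i‖
        ≤ C * (‖v (Fin.last n)‖ * mu q (m + n + 1) φ) * ∏ i, ‖Fin.init v i‖ := by gcongr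
      _ = _ := by
          simp only [Fin.init, ← add_assoc]
          ring

/-- Seminorm bounds for `u * φ`: there are `m` and `C`, depending on `u` and `q` only, with
`(1 + |x|)^q |D^n (u * φ)(x)| ≤ C μ_{q, m + n}(φ)`. -/
theorem convFun_decay {d : ℕ} {u : 𝓢'(E d, ℂ)} (hu : u ∈ OCPrime d) (q : ℕ) :
    ∃ (m : ℕ) (C : ℝ), 0 ≤ C ∧ ∀ (n : ℕ) (φ : 𝓢(E d, ℂ)) (x : E d),
      (1 + ‖x‖) ^ q * ‖iteratedFDeriv ℝ n (convFun u φ) x‖ ≤ C * mu q (m + n) φ := by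
  obtain ⟨m, C, hC, hb⟩ := convFun_bound hu q
  refine ⟨m, C, hC, fun n φ x => ?_⟩
  have hx : 0 < (1 + ‖x‖) ^ q := by positivity
  have hmu : 0 ≤ C * mu q (m + n) φ := mul_nonneg hC (mu_nonneg _ _ _)
  rw [mul_comm, ← le_div_iff₀ hx]
  refine ContinuousMultilinearMap.opNorm_le_bound (div_nonneg hmu hx.le) fun v => ?_
  rw [div_mul_eq_mul_div, le_div_iff₀ hx, mul_comm]
  exact iteratedFDeriv_convFun_bound hu q m C hC hb n φ x v

/-- The convolution `u * φ ∈ S(ℝ^d)` of `u ∈ O_C'(ℝ^d)` and `φ ∈ S(ℝ^d)`. -/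
noncomputable def conv {d : ℕ} (u : OCPrime d) (φ : 𝓢(E d, ℂ)) : 𝓢(E d, ℂ) where
  toFun := convFun u.1 φ
  smooth' := contDiff_convFun u.2 φ
  decay' := fun k n => by
    obtain ⟨m, C, -, h⟩ := convFun_decay u.2 k
    refine ⟨C * mu k (m + n) φ, fun x => le_trans ?_ (h n φ x)⟩
    gcongr
    linarith [norm_nonneg x]

/-! ### Mollifiers and the embedding `ι_S` -/

/-- `∫ ρ = 1` and all moments of `ρ` of positive order vanish. -/
def IsMollifier {d : ℕ} (ρ : 𝓢(E d, ℂ)) : Prop :=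
  ∫ x, ρ x = 1 ∧ ∀ m : Fin d → ℕ, m ≠ 0 → ∫ x : E d, (∏ i, (x i : ℂ) ^ m i) * ρ x = 0

/-- The dilation `x ↦ x / ε`. -/
noncomputable def dilation {d : ℕ} (ε : Set.Ioc (0 : ℝ) 1) : E d ≃L[ℝ] E d :=
  ContinuousLinearEquiv.smulLeft (Units.mk0 ((ε : ℝ)⁻¹) (inv_ne_zero ε.2.1.ne'))

theorem dilation_apply {d : ℕ} (ε : Set.Ioc (0 : ℝ) 1) (x : E d) :
    dilation ε x = (ε : ℝ)⁻¹ • x := rfl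

/-- `ρ_ε(x) = ε^{-d} ρ(x / ε)`. -/
noncomputable def scaled {d : ℕ} (ρ : 𝓢(E d, ℂ)) (ε : Set.Ioc (0 : ℝ) 1) : 𝓢(E d, ℂ) :=
  (((ε : ℝ) : ℂ) ^ d)⁻¹ • SchwartzMap.compCLMOfContinuousLinearEquiv ℂ (dilation ε) ρ

theorem scaled_apply {d : ℕ} (ρ : 𝓢(E d, ℂ)) (ε : Set.Ioc (0 : ℝ) 1) (x : E d) :
    scaled ρ ε x = (((ε : ℝ) : ℂ) ^ d)⁻¹ * ρ ((ε : ℝ)⁻¹ • x) := rfl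

theorem mu_scaled_le {d : ℕ} (q l : ℕ) (ρ : 𝓢(E d, ℂ)) (ε : Set.Ioc (0 : ℝ) 1) :
    mu q l (scaled ρ ε) ≤ ((ε : ℝ) ^ (d + l))⁻¹ * mu q l ρ := by
  have hε : 0 < (ε : ℝ) := ε.2.1
  have hε1 : 1 ≤ (ε : ℝ)⁻¹ := (one_le_inv₀ hε).mpr ε.2.2
  refine (mu_smul_le _ _ _ _).trans ?_
  have hc : ‖(((ε : ℝ) : ℂ) ^ d)⁻¹‖ = ((ε : ℝ) ^ d)⁻¹ := by
    rw [norm_inv, norm_pow, Complex.norm_real, Real.norm_of_nonneg hε.le]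
  rw [hc, pow_add, mul_inv, mul_assoc]
  gcongr
  refine mu_le fun n hn x => ?_
  rw [SchwartzMap.compCLMOfContinuousLinearEquiv_apply]
  have hg : ‖((dilation ε : E d ≃L[ℝ] E d) : E d →L[ℝ] E d)‖ ≤ (ε : ℝ)⁻¹ := by
    refine ContinuousLinearMap.opNorm_le_bound _ (by positivity) fun x => ?_
    change ‖dilation ε x‖ ≤ _
    rw [dilation_apply, norm_smul, Real.norm_of_nonneg (by positivity)]
  have h1 : ‖iteratedFDeriv ℝ n (ρ ∘ dilation ε) x‖ ≤
      ‖iteratedFDeriv ℝ n ρ (dilation ε x)‖ * ((ε : ℝ)⁻¹) ^ n := by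
    have := ContinuousLinearMap.iteratedFDeriv_comp_right ((dilation ε : E d ≃L[ℝ] E d) : E d →L[ℝ] E d)
      (ρ.smooth ⊤) x (i := n) (by exact_mod_cast le_top)
    change iteratedFDeriv ℝ n (ρ ∘ dilation ε) x = _ at this
    rw [this]
    refine (ContinuousMultilinearMap.norm_compContinuousLinearMap_le _ _).trans ?_
    rw [Finset.prod_const, Finset.card_univ, Fintype.card_fin]
    gcongr
    exact le_rfl
  have h2 : ‖x‖ ≤ ‖dilation ε x‖ := by
    rw [dilation_apply, norm_smul, Real.norm_of_nonneg (by positivity)]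
    exact le_mul_of_one_le_left (norm_nonneg x) hε1
  calc (1 + ‖x‖) ^ q * ‖iteratedFDeriv ℝ n (ρ ∘ dilation ε) x‖
      ≤ (1 + ‖dilation ε x‖) ^ q * (‖iteratedFDeriv ℝ n ρ (dilation ε x)‖ * ((ε : ℝ)⁻¹) ^ l) := by
        refine mul_le_mul (by gcongr) (h1.trans ?_) (norm_nonneg _) (by positivity)
        gcongr
    _ = ((ε : ℝ)⁻¹) ^ l * ((1 + ‖dilation ε x‖) ^ q * ‖iteratedFDeriv ℝ n ρ (dilation ε x)‖) := by ring
    _ ≤ _ := by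
        rw [inv_pow]
        gcongr
        exact le_mu hn ρ _

/-- The net `(u * ρ_ε)_ε` is moderate. -/
theorem regularization_mem_XS {d : ℕ} (ρ : 𝓢(E d, ℂ)) (u : OCPrime d) :
    (fun ε => conv u (scaled ρ ε) : Net d) ∈ XS d := by
  choose m C hC h using fun q => convFun_decay u.2 q
  refine ⟨fun p => ((d + (m p.1 + p.2) : ℕ) : ℝ≥0), trivial, fun q l => ?_⟩
  refine Asymptotics.IsBigO.of_bound (C q * mu q (m q + l) ρ) (Filter.Eventually.of_forall fun ε => ?_)
  have hε : 0 < (ε : ℝ) := ε.2.1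
  rw [Real.norm_of_nonneg (mu_nonneg _ _ _), Real.norm_of_nonneg (Real.rpow_nonneg hε.le _),
    NNReal.coe_natCast, Real.rpow_neg hε.le, Real.rpow_natCast]
  refine mu_le fun n hn x => ?_
  have hmono : mu q (m q + n) (scaled ρ ε) ≤ mu q (m q + l) (scaled ρ ε) :=
    mu_le fun i hi y => le_mu (hi.trans (Nat.add_le_add_left hn _)) _ y
  calc _ ≤ C q * mu q (m q + n) (scaled ρ ε) := h q n (scaled ρ ε) x
    _ ≤ C q * (((ε : ℝ) ^ (d + (m q + l)))⁻¹ * mu q (m q + l) ρ) := by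
        gcongr
        · exact hC q
        · exact hmono.trans (mu_scaled_le _ _ _ _)
    _ = _ := by ring

/-- The map `ι_S : O_C'(ℝ^d) → G_S(ℝ^d)`, `u ↦ [(u * ρ_ε)_ε]_S`. -/
noncomputable def iotaS {d : ℕ} (ρ : 𝓢(E d, ℂ)) (u : OCPrime d) : GS d :=
  GS.mk ⟨fun ε => conv u (scaled ρ ε), regularization_mem_XS ρ u⟩

end RapidlyDecreasing

namespace RapidlyDecreasing

open MeasureTheory LineDeriv

/-! ### Schwartz functions as rapidly decreasing distributions -/

/-! Write `w_ε = u * ρ_ε`. The inclusion of Schwartz functions rests on consistency of the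
embeddings: since all higher moments of `ρ` vanish, Taylor expansion gives, for every `m`, that
`μ_{q,l}(f * ρ_δ - f)` is at most a constant times `δ^(m+1) μ_{q,m+1+l}(f)`
(`IsMollifier.mu_conv_scaled_sub_le`). Hence `ι_S(f) = σ_S(f)`, and constant nets have exponent `0`.

Conversely, if `ι_S(u)` lies in `G_S^∞`, one exponent `b` satisfies `μ_{q,l}(w_ε) = O(ε^{-b})` for
all `(q,l)`. Since `w_ε * ρ_δ = w_δ * ρ_ε` (`conv_conv_comm`), `w_δ - w_ε = (w_ε * ρ_δ - w_ε) - (w_δ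
* ρ_ε - w_δ)`. With `δ = ε/2`, the estimate above with `m = b` bounds both terms by `O(ε^(b+1)
ε^{-b}) = O(ε)`: the extra `b + 1` derivatives cost nothing because `b` does not depend on `l`. So
`w_ε` is geometrically Cauchy in every seminorm along `ε = 2^{-k}` and has a Schwartz limit `f`. It
also converges weakly to `u`, whence `u = f`.

Commutation and weak convergence both use `⟨u * φ, ψ⟩ = ⟨u, ψ * φ(-·)⟩` (`integral_convFun_mul`).
There `u` is extended by Hahn–Banach to a Banach space in which the convolution is a Bochner
integral. -/

theorem integrable_one_add_norm_pow_mul {d : ℕ} (k : ℕ) (f : 𝓢(E d, ℂ)) :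
    Integrable (fun x => (1 + ‖x‖) ^ k * ‖f x‖) := by
  have h : (fun x : E d => (1 + ‖x‖) ^ k * ‖f x‖) =
      fun x => ∑ i ∈ Finset.range (k + 1), (k.choose i : ℝ) * (‖x‖ ^ i * ‖f x‖) := by
    ext x
    rw [add_comm, add_pow, Finset.sum_mul]
    refine Finset.sum_congr rfl fun i _ => ?_
    simp only [one_pow]
    ring
  rw [h]
  exact integrable_finsetSum _ fun i _ => (f.integrable_pow_mul volume i).const_mul _

theorem integrable_mul_schwartz {d : ℕ} {φ : E d → ℂ} (hφ : Continuous φ) {k : ℕ} {A : ℝ}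
    (h : ∀ x, ‖φ x‖ ≤ A * (1 + ‖x‖) ^ k) (f : 𝓢(E d, ℂ)) : Integrable (fun x => φ x * f x) := by
  refine ((integrable_one_add_norm_pow_mul k f).const_mul A).mono'
    (hφ.mul f.continuous).aestronglyMeasurable (Filter.Eventually.of_forall fun x => ?_)
  rw [norm_mul, ← mul_assoc]
  gcongr
  exact h x

theorem integrable_OC_mul {d : ℕ} (φ : OC d) (f : 𝓢(E d, ℂ)) :
    Integrable (fun x => (φ : E d → ℂ) x * f x) := by
  obtain ⟨k, hφ, hb⟩ := φ.2
  obtain ⟨C, hC⟩ := hb 0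
  exact integrable_mul_schwartz hφ.continuous (fun x => by simpa using hC x) f

/-- Integration against a Schwartz function, as a linear form on `O_C(ℝ^d)`. -/
noncomputable def integralForm {d : ℕ} (f : 𝓢(E d, ℂ)) : OC d →ₗ[ℂ] ℂ where
  toFun φ := ∫ x, (φ : E d → ℂ) x * f x
  map_add' φ ψ := by
    rw [← integral_add (integrable_OC_mul φ f) (integrable_OC_mul ψ f)]
    simp [add_mul]
  map_smul' c φ := by
    rw [RingHom.id_apply, smul_eq_mul, ← integral_const_mul]
    simp [mul_assoc]

theorem isContinuousOnOC_integralForm {d : ℕ} (f : 𝓢(E d, ℂ)) :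
    IsContinuousOnOC (integralForm f) := by
  refine fun k => ⟨0, ∫ x, (1 + ‖x‖) ^ k * ‖f x‖, fun φ _ A hA => ?_⟩
  rw [mul_comm, ← integral_const_mul]
  refine norm_integral_le_of_norm_le ((integrable_one_add_norm_pow_mul k f).const_mul A)
    (Filter.Eventually.of_forall fun x => ?_)
  rw [norm_mul, ← mul_assoc]
  gcongr
  simpa using hA 0 le_rfl x

theorem coe_mem_OCPrime {d : ℕ} (f : 𝓢(E d, ℂ)) : (f : 𝓢'(E d, ℂ)) ∈ OCPrime d :=
  ⟨integralForm f, isContinuousOnOC_integralForm f, fun φ => (SchwartzMap.coe_apply f φ).symm⟩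

/-- The inclusion `S(ℝ^d) ⊆ O_C'(ℝ^d)`. -/
noncomputable def ofSchwartz {d : ℕ} (f : 𝓢(E d, ℂ)) : OCPrime d := ⟨f, coe_mem_OCPrime f⟩

theorem convFun_coe {d : ℕ} (f φ : 𝓢(E d, ℂ)) (x : E d) :
    convFun (f : 𝓢'(E d, ℂ)) φ x = ∫ y, φ (x - y) * f y := by
  simp [convFun, reflectAt_apply]

theorem conv_apply {d : ℕ} (u : OCPrime d) (φ : 𝓢(E d, ℂ)) (x : E d) :
    conv u φ x = convFun u.1 φ x := rfl

theorem conv_ofSchwartz_apply {d : ℕ} (f φ : 𝓢(E d, ℂ)) (x : E d) :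
    conv (ofSchwartz f) φ x = ∫ y, φ (x - y) * f y :=
  convFun_coe f φ x

/-- Substitution `y ↦ x - y`. It allows the mollifier to play the role of the distribution, so that
derivatives fall on the function being regularized. -/
theorem conv_ofSchwartz_comm {d : ℕ} (f φ : 𝓢(E d, ℂ)) :
    conv (ofSchwartz f) φ = conv (ofSchwartz φ) f := by
  ext x
  rw [conv_ofSchwartz_apply, conv_ofSchwartz_apply, ← integral_sub_left_eq_self _ volume x]
  simp [mul_comm]

/-- Iterated directional derivatives fall on the second factor of a convolution. -/
theorem iteratedFDeriv_convFun_apply {d : ℕ} {u : 𝓢'(E d, ℂ)} (hu : u ∈ OCPrime d) (n : ℕ) :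
    ∀ (φ : 𝓢(E d, ℂ)) (x : E d) (v : Fin n → E d),
      iteratedFDeriv ℝ n (convFun u φ) x v = convFun u (∂^{v} φ) x := by
  induction n with
  | zero => intro φ x v; simp
  | succ n ih =>
    intro φ x v
    have hcd : ContDiff ℝ (⊤ : ℕ∞) (fderiv ℝ (convFun u φ)) :=
      (contDiff_convFun hu φ).fderiv_right (by simp)
    have hfun : (fun x => fderiv ℝ (convFun u φ) x (v (Fin.last n))) =
        convFun u (∂_{v (Fin.last n)} φ) := by
      ext x
      obtain ⟨L, hL, hLv⟩ := hasFDerivAt_convFun hu φ x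
      rw [hL.fderiv, hLv]
    rw [iteratedFDeriv_succ_apply_right, ← iteratedFDeriv_clm_apply_const_apply hcd
      (by exact_mod_cast le_top), hfun, iteratedLineDerivOp_succ_right]
    exact ih _ x (Fin.init v)

theorem mu_iteratedLineDeriv_le {d : ℕ} (q l n : ℕ) : ∀ (v : Fin n → E d) (φ : 𝓢(E d, ℂ)),
    mu q l (∂^{v} φ) ≤ (∏ i, ‖v i‖) * mu q (l + n) φ := by
  induction n with
  | zero => intro v φ; simp
  | succ n ih =>
    intro v φ
    rw [iteratedLineDerivOp_succ_right, Fin.prod_univ_castSucc]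
    refine (ih _ _).trans ?_
    rw [mul_assoc]
    exact mul_le_mul_of_nonneg_left (mu_lineDeriv_le q (l + n) _ φ)
      (Finset.prod_nonneg fun _ _ => norm_nonneg _)

/-! ### Taylor expansion and vanishing moments -/

theorem iteratedDeriv_comp_line {V : Type*} [NormedAddCommGroup V] [NormedSpace ℝ V]
    {F : Type*} [NormedAddCommGroup F] [NormedSpace ℝ F] {h : V → F}
    (hh : ContDiff ℝ (⊤ : ℕ∞) h) (x w : V) (j : ℕ) (t : ℝ) :
    iteratedDeriv j (fun s : ℝ => h (x + s • w)) t =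
      iteratedFDeriv ℝ j h (x + t • w) fun _ => w := by
  have h1 : (fun s : ℝ => h (x + s • w)) =
      (fun z => h (x + z)) ∘ (ContinuousLinearMap.toSpanSingleton ℝ w) := by
    ext s; simp
  have h2 : ContDiff ℝ (⊤ : ℕ∞) (fun z => h (x + z)) := hh.comp (contDiff_const.add contDiff_id)
  rw [iteratedDeriv_eq_iteratedFDeriv, h1,
    ContinuousLinearMap.iteratedFDeriv_comp_right _ h2 _ (by exact_mod_cast le_top),
    iteratedFDeriv_comp_add_left]
  simp

/-- One-variable Taylor formula on `[0, 1]` along the segment from `x` to `x + w`. The derivative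
bound is asked only on that segment, so `M` may depend on `x` and carry a decaying weight. -/
theorem norm_sub_taylor_le {V : Type*} [NormedAddCommGroup V] [NormedSpace ℝ V]
    {F : Type*} [NormedAddCommGroup F] [NormedSpace ℝ F] {h : V → F}
    (hh : ContDiff ℝ (⊤ : ℕ∞) h) (m : ℕ) (x w : V) {M : ℝ}
    (hM : ∀ t ∈ Set.Icc (0 : ℝ) 1, ‖iteratedFDeriv ℝ (m + 1) h (x + t • w)‖ ≤ M) :
    ‖h (x + w) - ∑ j ∈ Finset.range (m + 1),
      ((j.factorial : ℝ)⁻¹) • iteratedFDeriv ℝ j h x fun _ => w‖ ≤ M * ‖w‖ ^ (m + 1) := by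
  have hg : ContDiff ℝ (⊤ : ℕ∞) (fun s : ℝ => h (x + s • w)) :=
    hh.comp (contDiff_const.add (contDiff_id.smul contDiff_const))
  have hle (j : ℕ) : (j : WithTop ℕ∞) ≤ ((⊤ : ℕ∞) : WithTop ℕ∞) := by exact_mod_cast le_top
  have hit : ∀ (j : ℕ), ∀ t ∈ Set.Icc (0 : ℝ) 1,
      iteratedDerivWithin j (fun s : ℝ => h (x + s • w)) (Set.Icc 0 1) t =
        iteratedFDeriv ℝ j h (x + t • w) fun _ => w := fun j t ht => by
    rw [iteratedDerivWithin_eq_iteratedDeriv (uniqueDiffOn_Icc zero_lt_one)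
      (hg.of_le (hle j)).contDiffAt ht, iteratedDeriv_comp_line hh]
  have hM0 : 0 ≤ M := (norm_nonneg _).trans (hM 0 (by simp))
  have := taylor_mean_remainder_bound (f := fun s : ℝ => h (x + s • w)) (a := 0) (b := 1) (x := 1)
    (n := m) (C := M * ‖w‖ ^ (m + 1)) zero_le_one (hg.of_le (by exact_mod_cast hle (m + 1))).contDiffOn
    (by simp) (fun t ht => by
      rw [hit _ t ht]
      refine (ContinuousMultilinearMap.le_opNorm _ _).trans ?_
      rw [Finset.prod_const, Finset.card_univ, Fintype.card_fin]
      gcongr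
      exact hM t ht)
  rw [taylor_within_apply] at this
  simp only [sub_zero, one_pow, mul_one, one_smul] at this
  rw [Finset.sum_congr rfl fun j _ => by rw [hit j 0 (by simp)]] at this
  simp only [zero_smul, add_zero] at this
  -- The factor `1 / m!` of the remainder is discarded.
  refine this.trans (div_le_self (by positivity) ?_)
  exact_mod_cast Nat.succ_le_of_lt m.factorial_pos

theorem integrable_multilinear_mul {d j : ℕ} (M : (E d) [×j]→L[ℝ] ℂ) (ρ : 𝓢(E d, ℂ)) :
    Integrable fun y => (M fun _ => y) * ρ y := by
  refine integrable_mul_schwartz (k := j) (A := ‖M‖) ?_ (fun x => ?_) ρ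
  · exact M.cont.comp (continuous_pi fun _ => continuous_id)
  · refine (M.le_opNorm _).trans ?_
    rw [Finset.prod_const, Finset.card_univ, Fintype.card_fin]
    gcongr
    linarith

/-- Expanding `y` in the standard basis turns the diagonal of a multilinear form into monomials, the
form in which the moment conditions are stated. The exponent of `y k` counts the slots that `r`
sends to `k`. -/
theorem multilinear_apply_eq_sum {d j : ℕ} (M : (E d) [×j]→L[ℝ] ℂ) (y : E d) :
    (M fun _ => y) = ∑ r : Fin j → Fin d, (∏ k, (y k : ℂ) ^ (Finset.card {i | r i = k})) *
      M fun i => EuclideanSpace.single (r i) 1 := by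
  have hy : y = ∑ i, y i • EuclideanSpace.single i (1 : ℝ) := by
    ext k
    simp [Pi.single_apply]
  conv_lhs => rw [hy]
  rw [M.map_sum]
  refine Finset.sum_congr rfl fun r _ => ?_
  rw [M.map_smul_univ, Complex.real_smul]
  congr 1
  rw [← Finset.prod_fiberwise (s := Finset.univ) (g := r)]
  push_cast
  refine Finset.prod_congr rfl fun k _ => ?_
  rw [Finset.prod_congr rfl (g := fun _ => (y k : ℂ)) fun i hi => by
    rw [(Finset.mem_filter.mp hi).2], Finset.prod_const]

theorem IsMollifier.integral_multilinear_mul {d j : ℕ} {ρ : 𝓢(E d, ℂ)} (hρ : IsMollifier ρ)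
    (hj : j ≠ 0) (M : (E d) [×j]→L[ℝ] ℂ) : ∫ y, (M fun _ => y) * ρ y = 0 := by
  have hint : ∀ r : Fin j → Fin d, Integrable fun y : E d =>
      (∏ k, (y k : ℂ) ^ (Finset.card {i | r i = k})) * ρ y := fun r => by
    refine integrable_mul_schwartz (k := ∑ k, Finset.card {i | r i = k}) (A := 1) (by fun_prop)
      (fun y => ?_) ρ
    rw [one_mul, norm_prod, ← Finset.prod_pow_eq_pow_sum]
    refine Finset.prod_le_prod (fun _ _ => norm_nonneg _) fun k _ => ?_
    rw [norm_pow, Complex.norm_real]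
    gcongr
    linarith [PiLp.norm_apply_le y k]
  simp_rw [multilinear_apply_eq_sum M, Finset.sum_mul, mul_right_comm]
  rw [integral_finsetSum _ fun r _ => (hint r).mul_const _]
  refine Finset.sum_eq_zero fun r _ => ?_
  rw [integral_mul_const, hρ.2 _ fun h => ?_, zero_mul]
  -- The monomial is not constant: slot `0` lies in the fibre over `r 0`, so that exponent is
  -- positive.
  have := congrFun h (r ⟨0, Nat.pos_of_ne_zero hj⟩)
  rw [Pi.zero_apply, Finset.card_eq_zero] at this
  simpa using Finset.filter_eq_empty_iff.mp this (Finset.mem_univ ⟨0, Nat.pos_of_ne_zero hj⟩)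

/-- Vanishing moments kill every term of positive degree, and `∫ ρ = 1` preserves the constant term.
-/
theorem IsMollifier.integral_taylor_mul {d : ℕ} {ρ : 𝓢(E d, ℂ)} (hρ : IsMollifier ρ) (m : ℕ)
    (M : (j : ℕ) → (E d) [×j]→L[ℝ] ℂ) :
    Integrable (fun y => (∑ j ∈ Finset.range (m + 1), M j fun _ => y) * ρ y) ∧
      ∫ y, (∑ j ∈ Finset.range (m + 1), M j fun _ => y) * ρ y = M 0 0 := by
  simp_rw [Finset.sum_mul]
  refine ⟨integrable_finsetSum _ fun j _ => integrable_multilinear_mul _ ρ, ?_⟩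
  rw [integral_finsetSum _ fun j _ => integrable_multilinear_mul _ ρ, Finset.sum_range_succ',
    Finset.sum_eq_zero fun j _ => hρ.integral_multilinear_mul (Nat.succ_ne_zero j) _, zero_add]
  have : ∀ y : E d, (M 0 fun _ => y) = M 0 0 := fun y => congrArg _ (Subsingleton.elim _ _)
  simp_rw [this]
  rw [integral_const_mul, hρ.1, mul_one]

/-! ### Regularization of Schwartz functions -/

theorem integral_scaled {d : ℕ} (ρ : 𝓢(E d, ℂ)) (δ : Set.Ioc (0 : ℝ) 1) (g : E d → ℂ) :
    ∫ y, g y * scaled ρ δ y = ∫ y, g ((δ : ℝ) • y) * ρ y := by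
  have hδ : (0 : ℝ) < δ := δ.2.1
  have h : (fun y => g y * scaled ρ δ y) = fun y => (((δ : ℝ) : ℂ) ^ d)⁻¹ *
      (fun z => g ((δ : ℝ) • z) * ρ z) ((δ : ℝ)⁻¹ • y) := by
    ext y
    simp only [scaled_apply, smul_inv_smul₀ hδ.ne']
    ring
  rw [h, integral_const_mul, Measure.integral_comp_inv_smul volume
    (fun z => g ((δ : ℝ) • z) * ρ z), finrank_euclideanSpace_fin,
    abs_of_nonneg (by positivity), Complex.real_smul]
  push_cast
  rw [inv_mul_cancel_left₀]
  exact pow_ne_zero _ (by exact_mod_cast hδ.ne')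

/-- Peetre-type inequality: the weight moves to a shifted point at the price of a factor in the
shift, which the decay of `ρ` absorbs. -/
theorem one_add_norm_le_mul {V : Type*} [SeminormedAddCommGroup V] (x w : V) :
    1 + ‖x‖ ≤ (1 + ‖x + w‖) * (1 + ‖w‖) := by
  have : ‖x‖ ≤ ‖x + w‖ + ‖w‖ := by simpa using norm_sub_le (x + w) w
  nlinarith [norm_nonneg (x + w), norm_nonneg w, mul_nonneg (norm_nonneg (x + w)) (norm_nonneg w)]

/-- After rescaling, the difference is the integral against `ρ` of the Taylor remainder of `h` at
`x` with increment `-δ y`. This remainder yields `δ^(m+1) |y|^(m+1)`, and moving the weight costs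
`(1 + |y|)^q`; both powers of `y` are integrable against `ρ`. -/
theorem IsMollifier.convFun_scaled_sub_le {d : ℕ} {ρ : 𝓢(E d, ℂ)} (hρ : IsMollifier ρ) (q m : ℕ)
    (δ : Set.Ioc (0 : ℝ) 1) (h : 𝓢(E d, ℂ)) (x : E d) :
    (1 + ‖x‖) ^ q * ‖convFun (scaled ρ δ : 𝓢'(E d, ℂ)) h x - h x‖ ≤
      (∫ y, (1 + ‖y‖) ^ (q + (m + 1)) * ‖ρ y‖) * (δ : ℝ) ^ (m + 1) * mu q (m + 1) h := by
  have hδ : (0 : ℝ) < δ := δ.2.1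
  -- The Taylor coefficients with `(-δ)^j` absorbed, so that they are forms in `y` itself.
  let M : (j : ℕ) → (E d) [×j]→L[ℝ] ℂ := fun j =>
    ((j.factorial : ℝ)⁻¹ * (-(δ : ℝ)) ^ j) • iteratedFDeriv ℝ j h x
  have hMw : ∀ (y : E d) (j : ℕ), (M j fun _ => y) =
      ((j.factorial : ℝ)⁻¹) • iteratedFDeriv ℝ j h x fun _ => (-(δ : ℝ)) • y := fun y j => by
    rw [ContinuousMultilinearMap.map_smul_univ, Finset.prod_const, Finset.card_univ,
      Fintype.card_fin, smul_smul]
    rfl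
  obtain ⟨hint, hval⟩ := hρ.integral_taylor_mul m M
  have h0 : M 0 0 = h x := by simp [M]
  have hint' : Integrable fun y => h (x - (δ : ℝ) • y) * ρ y :=
    integrable_mul_schwartz (k := 0) (A := mu 0 0 h) (by fun_prop)
      (fun y => by
        simpa using le_mu (q := 0) (n := 0) le_rfl h (x - (δ : ℝ) • y)) ρ
  have hx : 0 < (1 + ‖x‖) ^ q := by positivity
  rw [convFun_coe, integral_scaled ρ δ fun y => h (x - y), ← h0, ← hval,
    ← integral_sub hint' hint, ← le_div_iff₀' hx]
  have hbound : ∀ y, ‖h (x - (δ : ℝ) • y) * ρ y - (∑ j ∈ Finset.range (m + 1), M j fun _ => y) * ρ y‖ ≤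
      ((δ : ℝ) ^ (m + 1) * mu q (m + 1) h / (1 + ‖x‖) ^ q) *
        ((1 + ‖y‖) ^ (q + (m + 1)) * ‖ρ y‖) := fun y => by
    have key := norm_sub_taylor_le (h.smooth ⊤) m x ((-(δ : ℝ)) • y)
      (M := mu q (m + 1) h * (1 + ‖y‖) ^ q / (1 + ‖x‖) ^ q) (fun t ht => by
        rw [le_div_iff₀' hx]
        have h1 := one_add_norm_le_mul x (t • (-(δ : ℝ)) • y)
        have h2 : ‖t • (-(δ : ℝ)) • y‖ ≤ ‖y‖ := by
          rw [norm_smul, norm_smul, norm_neg, Real.norm_of_nonneg ht.1, Real.norm_of_nonneg hδ.le,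
            ← mul_assoc]
          exact mul_le_of_le_one_left (norm_nonneg _) (mul_le_one₀ ht.2 hδ.le δ.2.2)
        have h3 : 1 + ‖x‖ ≤ (1 + ‖x + t • (-(δ : ℝ)) • y‖) * (1 + ‖y‖) := h1.trans (by gcongr)
        calc _ ≤ ((1 + ‖x + t • (-(δ : ℝ)) • y‖) * (1 + ‖y‖)) ^ q *
              ‖iteratedFDeriv ℝ (m + 1) h (x + t • (-(δ : ℝ)) • y)‖ := by gcongr
          _ = ((1 + ‖x + t • (-(δ : ℝ)) • y‖) ^ q *
              ‖iteratedFDeriv ℝ (m + 1) h (x + t • (-(δ : ℝ)) • y)‖) * (1 + ‖y‖) ^ q := by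
            rw [mul_pow]; ring
          _ ≤ _ := by
            gcongr
            exact le_mu le_rfl h _)
    simp_rw [← hMw] at key
    rw [← sub_mul, norm_mul, ← mul_assoc]
    gcongr
    have hxy : x - (δ : ℝ) • y = x + (-(δ : ℝ)) • y := by rw [neg_smul, sub_eq_add_neg]
    rw [hxy]
    refine key.trans ?_
    rw [norm_smul, norm_neg, Real.norm_of_nonneg hδ.le, mul_pow, pow_add _ q]
    have := mu_nonneg q (m + 1) h
    calc _ = (mu q (m + 1) h * (1 + ‖y‖) ^ q / (1 + ‖x‖) ^ q * (δ : ℝ) ^ (m + 1)) *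
          ‖y‖ ^ (m + 1) := by ring
      _ ≤ (mu q (m + 1) h * (1 + ‖y‖) ^ q / (1 + ‖x‖) ^ q * (δ : ℝ) ^ (m + 1)) *
          (1 + ‖y‖) ^ (m + 1) := by
        gcongr
        linarith
      _ = _ := by ring
  refine (norm_integral_le_of_norm_le ((integrable_one_add_norm_pow_mul _ ρ).const_mul _)
    (Filter.Eventually.of_forall hbound)).trans (le_of_eq ?_)
  rw [integral_const_mul]
  ring

/-- Regularization by a mollifier with vanishing moments approximates Schwartz functions to
arbitrary order. -/
theorem IsMollifier.mu_conv_scaled_sub_le {d : ℕ} {ρ : 𝓢(E d, ℂ)} (hρ : IsMollifier ρ)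
    (q l m : ℕ) (δ : Set.Ioc (0 : ℝ) 1) (f : 𝓢(E d, ℂ)) :
    mu q l (conv (ofSchwartz f) (scaled ρ δ) - f) ≤
      (∫ y, (1 + ‖y‖) ^ (q + (m + 1)) * ‖ρ y‖) * (δ : ℝ) ^ (m + 1) * mu q (m + 1 + l) f := by
  set C := ∫ y : E d, (1 + ‖y‖) ^ (q + (m + 1)) * ‖ρ y‖
  have hC : 0 ≤ C := integral_nonneg fun y => by positivity
  have hδ : (0 : ℝ) < δ := δ.2.1
  rw [conv_ofSchwartz_comm]
  refine mu_le fun n hn x => ?_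
  have hx : 0 < (1 + ‖x‖) ^ q := by positivity
  have hmono : mu q (m + 1 + n) f ≤ mu q (m + 1 + l) f :=
    mu_le fun i hi y => le_mu (hi.trans (Nat.add_le_add_left hn _)) _ y
  have hB : 0 ≤ C * (δ : ℝ) ^ (m + 1) * mu q (m + 1 + l) f :=
    mul_nonneg (by positivity) (mu_nonneg _ _ _)
  rw [← le_div_iff₀' hx]
  refine ContinuousMultilinearMap.opNorm_le_bound (div_nonneg hB hx.le) fun v => ?_
  have hcoe : ((conv (ofSchwartz (scaled ρ δ)) f - f : 𝓢(E d, ℂ)) : E d → ℂ) =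
      (conv (ofSchwartz (scaled ρ δ)) f : E d → ℂ) - f := by ext; rfl
  have hc : ((conv (ofSchwartz (scaled ρ δ)) f : 𝓢(E d, ℂ)) : E d → ℂ) =
    convFun (scaled ρ δ : 𝓢'(E d, ℂ)) f := rfl
  -- For fixed directions `v`, derivatives commute with the convolution, so the order-zero estimate
  -- applies to `∂^{v} f`.
  rw [hcoe, iteratedFDeriv_sub_apply (SchwartzMap.smooth _ n).contDiffAt (f.smooth n).contDiffAt,
    sub_apply, hc, iteratedFDeriv_convFun_apply (coe_mem_OCPrime _),
    ← SchwartzMap.iteratedLineDerivOp_eq_iteratedFDeriv, div_mul_eq_mul_div, le_div_iff₀' hx]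
  refine (hρ.convFun_scaled_sub_le q m δ _ x).trans ?_
  have hp : 0 ≤ ∏ i, ‖v i‖ := Finset.prod_nonneg fun _ _ => norm_nonneg _
  calc _ ≤ C * (δ : ℝ) ^ (m + 1) * ((∏ i, ‖v i‖) * mu q (m + 1 + n) f) := by
        gcongr
        exact mu_iteratedLineDeriv_le _ _ _ _ _
    _ ≤ C * (δ : ℝ) ^ (m + 1) * ((∏ i, ‖v i‖) * mu q (m + 1 + l) f) := by gcongr
    _ = _ := by ring

/-! ### Interchange of a rapidly decreasing distribution with an integral -/

/-- A linear form controlled by the norm of an injective linear map into a normed space factors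
through a continuous linear form. -/
theorem exists_dual_comp_eq {V B : Type*} [AddCommGroup V] [Module ℂ V] [NormedAddCommGroup B]
    [NormedSpace ℂ B] (J : V →ₗ[ℂ] B) (hJ : Function.Injective J) (u : V →ₗ[ℂ] ℂ) (C : ℝ)
    (h : ∀ v, ‖u v‖ ≤ C * ‖J v‖) : ∃ g : StrongDual ℂ B, ∀ v, g (J v) = u v := by
  let e := LinearEquiv.ofInjective J hJ
  let f : StrongDual ℂ (LinearMap.range J) :=
    (u.comp e.symm.toLinearMap).mkContinuous C fun x => by
      obtain ⟨v, rfl⟩ := e.surjective x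
      simpa using! h v
  -- Hahn–Banach, applied to the form transported to the range of `J`.
  obtain ⟨g, hg, -⟩ := exists_extension_norm_eq _ f
  refine ⟨g, fun v => ?_⟩
  have h1 := hg (e v)
  have h2 : ((e v : LinearMap.range J) : B) = J v := rfl
  rw [h2] at h1
  rw [h1]
  simp [f]

/-- Bounded continuous functions with values in the `n`-linear forms. -/
abbrev BoundedForms (d n : ℕ) : Type := BoundedContinuousFunction (E d) ((E d) [×n]→L[ℝ] ℂ)

noncomputable instance (d n : ℕ) : NormedAddCommGroup (BoundedForms d n) := inferInstance

noncomputable instance (d n : ℕ) : NormedSpace ℂ (BoundedForms d n) := inferInstance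

noncomputable instance (d n : ℕ) : NormedSpace ℝ (BoundedForms d n) := inferInstance

noncomputable instance (d m : ℕ) : NormedAddCommGroup ((n : Fin (m + 1)) → BoundedForms d n) :=
  Pi.normedAddCommGroup

noncomputable instance (d m : ℕ) : NormedSpace ℂ ((n : Fin (m + 1)) → BoundedForms d n) :=
  Pi.normedSpace

/-- The derivative `D^n φ` of a Schwartz function as a bounded continuous function. -/
noncomputable def boundedIteratedFDeriv {d : ℕ} (n : ℕ) :
    𝓢(E d, ℂ) →ₗ[ℂ] BoundedForms d n where
  toFun φ := BoundedContinuousFunction.ofNormedAddCommGroup (iteratedFDeriv ℝ n φ)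
    ((φ.smooth n).continuous_iteratedFDeriv le_rfl) (mu 0 n φ)
    fun x => by simpa using le_mu (q := 0) le_rfl φ x
  map_add' φ ψ := by
    ext1 x
    exact iteratedFDeriv_add_apply (φ.smooth n).contDiffAt (ψ.smooth n).contDiffAt
  map_smul' c φ := by
    ext1 x
    exact iteratedFDeriv_const_smul_apply (φ.smooth n).contDiffAt

theorem boundedIteratedFDeriv_apply {d n : ℕ} (φ : 𝓢(E d, ℂ)) (x : E d) :
    boundedIteratedFDeriv n φ x = iteratedFDeriv ℝ n φ x := rfl

theorem iteratedFDeriv_reflectAt {d : ℕ} (n : ℕ) (φ : 𝓢(E d, ℂ)) (x z : E d) :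
    iteratedFDeriv ℝ n (reflectAt x φ) z = iteratedFDeriv ℝ n (reflectAt 0 φ) (z - x) := by
  rw [← iteratedFDeriv_comp_sub]
  congr 1
  ext z
  simp [reflectAt_apply]

/-- Changing `x` translates a fixed function, so the mean value inequality with the next derivative
applies. The resulting continuity in sup norm makes the Bochner integrand strongly measurable. -/
theorem lipschitzWith_boundedIteratedFDeriv_reflectAt {d : ℕ} (n : ℕ) (φ : 𝓢(E d, ℂ)) :
    LipschitzWith (mu 0 (n + 1) (reflectAt 0 φ)).toNNReal
      fun x => boundedIteratedFDeriv n (reflectAt x φ) := by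
  refine LipschitzWith.of_dist_le_mul fun x y => ?_
  rw [Real.coe_toNNReal _ (mu_nonneg _ _ _)]
  refine (BoundedContinuousFunction.dist_le
    (mul_nonneg (mu_nonneg _ _ _) dist_nonneg)).mpr fun z => ?_
  rw [boundedIteratedFDeriv_apply, boundedIteratedFDeriv_apply, iteratedFDeriv_reflectAt n φ x,
    iteratedFDeriv_reflectAt n φ y, dist_eq_norm]
  have := Convex.norm_image_sub_le_of_norm_fderiv_le (𝕜 := ℝ)
    (f := iteratedFDeriv ℝ n (reflectAt 0 φ)) (s := Set.univ) (C := mu 0 (n + 1) (reflectAt 0 φ))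
    (x := z - y) (y := z - x)
    (fun w _ => ((SchwartzMap.smooth _ ⊤).differentiable_iteratedFDeriv
      (by exact_mod_cast ENat.natCast_lt_top n)) w)
    (fun w _ => by
      rw [norm_fderiv_iteratedFDeriv]
      simpa using le_mu (q := 0) le_rfl (reflectAt 0 φ) w)
    convex_univ trivial trivial
  rwa [sub_sub_sub_cancel_left, norm_sub_rev y, ← dist_eq_norm x] at this

theorem norm_boundedIteratedFDeriv_reflectAt_le {d : ℕ} (n : ℕ) (φ : 𝓢(E d, ℂ)) (x : E d) :
    ‖boundedIteratedFDeriv n (reflectAt x φ)‖ ≤ mu 0 n φ := by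
  refine (BoundedContinuousFunction.norm_le (mu_nonneg _ _ _)).mpr fun z => ?_
  rw [boundedIteratedFDeriv_apply, norm_iteratedFDeriv_reflectAt]
  simpa using le_mu (q := 0) le_rfl φ (x - z)

theorem integrable_smul_boundedIteratedFDeriv {d : ℕ} (n : ℕ) (φ ψ : 𝓢(E d, ℂ)) :
    Integrable fun x => ψ x • boundedIteratedFDeriv n (reflectAt x φ) := by
  refine (ψ.integrable.norm.mul_const (mu 0 n φ)).mono'
    (ψ.continuous.smul (lipschitzWith_boundedIteratedFDeriv_reflectAt n φ).continuous).aestronglyMeasurable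
    (Filter.Eventually.of_forall fun x => ?_)
  rw [norm_smul]
  gcongr
  exact norm_boundedIteratedFDeriv_reflectAt_le n φ x

/-- Evaluation at a point and at a tuple of vectors are continuous linear, hence commute with the
Bochner integral. What remains is differentiation of a convolution on its second factor. -/
theorem integral_smul_boundedIteratedFDeriv {d : ℕ} (n : ℕ) (φ ψ : 𝓢(E d, ℂ)) :
    ∫ x, ψ x • boundedIteratedFDeriv n (reflectAt x φ) =
      boundedIteratedFDeriv n (conv (ofSchwartz ψ) (reflectAt 0 φ)) := by
  have hint := integrable_smul_boundedIteratedFDeriv n φ ψ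
  ext z v
  have h1 := ((BoundedContinuousFunction.evalCLM ℝ z).integral_comp_comm hint).symm
  have h2 := ((ContinuousMultilinearMap.apply ℝ (fun _ : Fin n => E d) ℂ v).integral_comp_comm
    ((BoundedContinuousFunction.evalCLM ℝ z).integrable_comp hint)).symm
  simp only [BoundedContinuousFunction.evalCLM_apply] at h1 h2
  rw [h1]
  refine h2.trans ?_
  have hc : ((conv (ofSchwartz ψ) (reflectAt 0 φ) : 𝓢(E d, ℂ)) : E d → ℂ) =
    convFun (ψ : 𝓢'(E d, ℂ)) (reflectAt 0 φ) := rfl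
  rw [boundedIteratedFDeriv_apply, hc, iteratedFDeriv_convFun_apply (coe_mem_OCPrime _),
    convFun_coe]
  refine integral_congr_ae (Filter.Eventually.of_forall fun x => ?_)
  simp only [SchwartzMap.iteratedLineDerivOp_eq_iteratedFDeriv, ← iteratedFDeriv_reflectAt]
  exact mul_comm _ _

set_option synthInstance.maxHeartbeats 400000 in
/-- `⟨u * φ, ψ⟩ = ⟨u, ψ * φ(-·)⟩`. -/
theorem integral_convFun_mul {d : ℕ} {u : 𝓢'(E d, ℂ)} (hu : u ∈ OCPrime d) (φ ψ : 𝓢(E d, ℂ)) :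
    ∫ x, ψ x * convFun u φ x = u (conv (ofSchwartz ψ) (reflectAt 0 φ)) := by
  -- With weight exponent `0`, `u` is controlled by finitely many sup norms of derivatives, that is
  -- by the norm of `J` below.
  obtain ⟨m, C, hC, h⟩ := OCPrime.bound hu 0
  let J : 𝓢(E d, ℂ) →ₗ[ℂ] ((n : Fin (m + 1)) → BoundedForms d n) :=
    LinearMap.pi fun n => boundedIteratedFDeriv n
  have hJ : Function.Injective J := fun φ ψ hφψ => by
    ext x
    have h0 : iteratedFDeriv ℝ 0 φ x = iteratedFDeriv ℝ 0 ψ x :=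
      DFunLike.congr_fun (congrFun hφψ 0) x
    simpa using congrArg (fun M => M 0) h0
  obtain ⟨g, hg⟩ := exists_dual_comp_eq J hJ (u : 𝓢(E d, ℂ) →ₗ[ℂ] ℂ) C fun χ => by
    refine h χ ‖J χ‖ (norm_nonneg _) fun n hn x => ?_
    rw [pow_zero, mul_one]
    exact ((boundedIteratedFDeriv n χ).norm_coe_le_norm x).trans
      (norm_le_pi_norm (J χ) ⟨n, Nat.lt_succ_iff.mpr hn⟩)
  have hev : ∀ n : Fin (m + 1), Integrable fun x => (ψ x • J (reflectAt x φ)) n :=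
    fun n => integrable_smul_boundedIteratedFDeriv n φ ψ
  have hint : Integrable fun x => ψ x • J (reflectAt x φ) := Integrable.of_eval hev
  have hI : ∫ x, ψ x • J (reflectAt x φ) = J (conv (ofSchwartz ψ) (reflectAt 0 φ)) := by
    ext1 n
    rw [eval_integral hev]
    exact integral_smul_boundedIteratedFDeriv n φ ψ
  have h1 := g.integral_comp_comm hint
  rw [hI, hg] at h1
  refine Eq.trans (integral_congr_ae (Filter.Eventually.of_forall fun x => ?_)) h1
  simp only [map_smul, hg, smul_eq_mul]
  rfl

/-- Successive regularizations commute. -/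
theorem conv_conv_comm {d : ℕ} (u : OCPrime d) (φ ψ : 𝓢(E d, ℂ)) :
    conv (ofSchwartz (conv u φ)) ψ = conv (ofSchwartz (conv u ψ)) φ := by
  -- Duality reduces both sides to `u` applied to one test function, whose symmetry in `φ` and `ψ`
  -- is then checked by the substitution `y ↦ x + z - y`.
  have key : ∀ (φ ψ : 𝓢(E d, ℂ)) (x : E d), conv (ofSchwartz (conv u φ)) ψ x =
      u.1 (conv (ofSchwartz (reflectAt x ψ)) (reflectAt 0 φ)) := fun φ ψ x => by
    rw [conv_ofSchwartz_apply, ← integral_convFun_mul u.2]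
    simp only [reflectAt_apply, conv_apply]
  ext x
  rw [key, key]
  congr 1
  ext z
  rw [conv_ofSchwartz_apply, conv_ofSchwartz_apply, ← integral_sub_left_eq_self _ volume (x + z)]
  refine integral_congr_ae (Filter.Eventually.of_forall fun y => ?_)
  simp only [reflectAt_apply]
  rw [mul_comm]
  congr 2 <;> abel

/-! ### Consistency of the embeddings -/

theorem mu_neg_le {d : ℕ} (q l : ℕ) (f : 𝓢(E d, ℂ)) : mu q l (-f) ≤ mu q l f := by
  have := mu_smul_le q l (-1) f
  rwa [neg_one_smul, norm_neg, norm_one, one_mul] at this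

/-- The embedding of `O_C'(ℝ^d)` extends the embedding of `S(ℝ^d)` by constant nets. -/
theorem IsMollifier.iotaS_ofSchwartz {d : ℕ} {ρ : 𝓢(E d, ℂ)} (hρ : IsMollifier ρ)
    (f : 𝓢(E d, ℂ)) : iotaS ρ (ofSchwartz f) = sigmaS f := by
  refine (Submodule.Quotient.eq _).mpr fun q l m => ?_
  refine Asymptotics.IsBigO.of_bound
    ((∫ y, (1 + ‖y‖) ^ (q + (m + 1)) * ‖ρ y‖) * mu q (m + 1 + l) f)
    (Filter.Eventually.of_forall fun ε => ?_)
  have hC : 0 ≤ ∫ y, (1 + ‖y‖) ^ (q + (m + 1)) * ‖ρ y‖ := integral_nonneg fun y => by positivity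
  have hμ := mu_nonneg q (m + 1 + l) f
  have hε := ε.2.1.le
  rw [Real.norm_of_nonneg (mu_nonneg _ _ _), Real.norm_of_nonneg (Real.rpow_nonneg hε _),
    Real.rpow_natCast]
  refine (hρ.mu_conv_scaled_sub_le q l m ε f).trans ?_
  rw [mul_right_comm]
  exact mul_le_mul_of_nonneg_left (pow_le_pow_of_le_one hε ε.2.2 (Nat.le_succ m)) (mul_nonneg hC hμ)

theorem sigmaS_mem_GSInfty {d : ℕ} (f : 𝓢(E d, ℂ)) : sigmaS f ∈ GSInfty d := by
  refine ⟨⟨fun _ => f, const_mem_XS f⟩, ⟨0, ⟨0, ?_⟩, fun q l => ?_⟩, rfl⟩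
  · rintro _ ⟨p, rfl⟩
    exact le_rfl
  · change GrowthBound (fun _ => f) q l _
    simp only [GrowthBound, Pi.zero_apply, NNReal.coe_zero, neg_zero, Real.rpow_zero]
    exact Asymptotics.isBigO_const_const _ one_ne_zero _

/-! ### Convergence of the regularizations -/

/-- Reflection only multiplies each moment by a sign. It is needed because duality places the
reflected mollifier on the test function. -/
theorem IsMollifier.reflect {d : ℕ} {ρ : 𝓢(E d, ℂ)} (hρ : IsMollifier ρ) :
    IsMollifier (reflectAt 0 ρ) := by
  refine ⟨?_, fun m hm => ?_⟩
  · simp only [reflectAt_apply, zero_sub]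
    rw [integral_neg_eq_self (fun x => ρ x) volume]
    exact hρ.1
  · rw [← integral_neg_eq_self (μ := volume)]
    have h : ∀ x : E d, (∏ i, ((-x) i : ℂ) ^ m i) * reflectAt 0 ρ (-x) =
        (∏ i, (-1 : ℂ) ^ m i) * ((∏ i, (x i : ℂ) ^ m i) * ρ x) := fun x => by
      rw [reflectAt_apply, sub_neg_eq_add, zero_add, ← mul_assoc, ← Finset.prod_mul_distrib]
      congr 1
      refine Finset.prod_congr rfl fun i _ => ?_
      rw [← mul_pow]
      simp
    simp_rw [h]
    rw [integral_const_mul, hρ.2 m hm, mul_zero]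

theorem reflectAt_zero_scaled {d : ℕ} (ρ : 𝓢(E d, ℂ)) (ε : Set.Ioc (0 : ℝ) 1) :
    reflectAt 0 (scaled ρ ε) = scaled (reflectAt 0 ρ) ε := by
  ext x
  simp [reflectAt_apply, scaled_apply]

/-- The regularizations of `u ∈ O_C'(ℝ^d)` converge weakly to `u`. -/
theorem IsMollifier.norm_integral_conv_sub_le {d : ℕ} {ρ : 𝓢(E d, ℂ)} (hρ : IsMollifier ρ)
    (u : OCPrime d) (φ : 𝓢(E d, ℂ)) : ∃ C : ℝ, ∀ ε : Set.Ioc (0 : ℝ) 1,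
      ‖(∫ x, φ x * conv u (scaled ρ ε) x) - u.1 φ‖ ≤ C * ε := by
  obtain ⟨m, C, hC, h⟩ := OCPrime.bound u.2 0
  refine ⟨C * ((∫ y, (1 + ‖y‖) ^ (0 + (0 + 1)) * ‖reflectAt 0 ρ y‖) * mu 0 (0 + 1 + m) φ),
    fun ε => ?_⟩
  -- The regularization passes to `φ`, where the Taylor estimate with `m = 0` already gives the rate
  -- `ε`.
  have hkey := integral_convFun_mul u.2 (scaled ρ ε) φ
  simp only [conv_apply]
  rw [hkey, reflectAt_zero_scaled, ← map_sub]
  refine (h _ (mu 0 m _) (mu_nonneg _ _ _) fun n hn x => ?_).trans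
    ((mul_le_mul_of_nonneg_left (hρ.reflect.mu_conv_scaled_sub_le 0 m 0 ε φ) hC).trans
      (le_of_eq (by ring)))
  simpa using le_mu (q := 0) hn (conv (ofSchwartz φ) (scaled (reflectAt 0 ρ) ε) - φ) x

/-! ### Geometrically Cauchy sequences of Schwartz functions -/

/-- The sum of a geometrically convergent series of Schwartz functions. -/
theorem exists_schwartz_hasSum {d : ℕ} (g : ℕ → 𝓢(E d, ℂ)) (C : ℕ → ℕ → ℝ)
    (h : ∀ q l k, mu q l (g k) ≤ C q l * (1 / 2 : ℝ) ^ k) :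
    ∃ f : 𝓢(E d, ℂ), ∀ x, HasSum (fun k => g k x) (f x) := by
  have hs (q l : ℕ) : Summable fun k => C q l * (1 / 2 : ℝ) ^ k :=
    summable_geometric_two.mul_left _
  have hb (q n k : ℕ) (x : E d) : (1 + ‖x‖) ^ q * ‖iteratedFDeriv ℝ n (g k) x‖ ≤
      C q n * (1 / 2 : ℝ) ^ k := (le_mu le_rfl _ x).trans (h q n k)
  have hb0 (n k : ℕ) (x : E d) : ‖iteratedFDeriv ℝ n (g k) x‖ ≤ C 0 n * (1 / 2 : ℝ) ^ k := by
    simpa using hb 0 n k x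
  refine ⟨⟨fun x => ∑' k, g k x, ?_, fun q n => ?_⟩, fun x => ?_⟩
  · exact contDiff_tsum (N := ⊤) (fun k => (g k).smooth ⊤) (fun n _ => hs 0 n)
      fun n k x _ => hb0 n k x
  · refine ⟨∑' k, C q n * (1 / 2 : ℝ) ^ k, fun x => ?_⟩
    rw [iteratedFDeriv_tsum_apply (N := ⊤) (fun k => (g k).smooth ⊤) (fun n _ => hs 0 n)
      (fun n k x _ => hb0 n k x) le_top]
    calc ‖x‖ ^ q * ‖∑' k, iteratedFDeriv ℝ n (g k) x‖
        ≤ (1 + ‖x‖) ^ q * ‖∑' k, iteratedFDeriv ℝ n (g k) x‖ := by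
          gcongr
          linarith [norm_nonneg x]
      _ = ‖∑' k, (1 + ‖x‖) ^ q • iteratedFDeriv ℝ n (g k) x‖ := by
          rw [tsum_const_smul'', norm_smul, Real.norm_of_nonneg (by positivity)]
      _ ≤ _ := tsum_of_norm_bounded (hs q n).hasSum fun k => by
          rw [norm_smul, Real.norm_of_nonneg (by positivity)]
          exact hb q n k x
  · refine Summable.hasSum (Summable.of_norm_bounded (hs 0 0) fun k => ?_)
    simpa using hb0 0 k x

/-- Telescoping: the limit is `w 0` plus the sum of the increments. Only the uniform rate is
recorded, which suffices to identify the limit weakly. -/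
theorem exists_schwartz_limit {d : ℕ} (w : ℕ → 𝓢(E d, ℂ)) (C : ℕ → ℕ → ℝ)
    (h : ∀ q l k, mu q l (w (k + 1) - w k) ≤ C q l * (1 / 2 : ℝ) ^ k) :
    ∃ f : 𝓢(E d, ℂ), ∀ k x, ‖w k x - f x‖ ≤ 2 * C 0 0 * (1 / 2 : ℝ) ^ k := by
  obtain ⟨g, hg⟩ := exists_schwartz_hasSum _ C h
  refine ⟨w 0 + g, fun k x => ?_⟩
  have hlim : Filter.Tendsto (fun k => w k x) Filter.atTop (𝓝 ((w 0 + g) x)) := by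
    have := (hg x).tendsto_sum_nat.const_add (w 0 x)
    refine this.congr fun n => ?_
    simp only [sub_apply]
    rw [Finset.sum_range_sub fun k => w k x]
    ring
  have hdist : ∀ k, dist (w k x) (w (k + 1) x) ≤ 2 * C 0 0 / 2 / 2 ^ k := fun k => by
    rw [dist_comm, dist_eq_norm]
    have := (le_mu (q := 0) (l := 0) le_rfl (w (k + 1) - w k) x).trans (h 0 0 k)
    rw [norm_iteratedFDeriv_zero, pow_zero, one_mul, sub_apply] at this
    refine this.trans (le_of_eq ?_)
    rw [one_div, inv_pow]
    ring
  have := dist_le_of_le_geometric_two_of_tendsto hdist hlim k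
  rw [dist_eq_norm] at this
  refine this.trans (le_of_eq ?_)
  rw [one_div, inv_pow, div_eq_mul_inv]

/-! ### Regularity -/

/-- The sequence `2^{-k}` in `(0, 1]`. -/
noncomputable def epsSeq (k : ℕ) : Set.Ioc (0 : ℝ) 1 :=
  ⟨(1 / 2) ^ k, by positivity, pow_le_one₀ (by norm_num) (by norm_num)⟩

theorem epsSeq_val (k : ℕ) : (epsSeq k : ℝ) = (1 / 2) ^ k := rfl

theorem tendsto_epsSeq : Filter.Tendsto epsSeq Filter.atTop epsToZero :=
  Filter.tendsto_comap_iff.mpr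
    (tendsto_pow_atTop_nhdsWithin_zero_of_lt_one (by norm_num) (by norm_num))

theorem GS.mk_eq_mk_iff {d : ℕ} {f g : XS d} :
    GS.mk f = GS.mk g ↔ (f : Net d) - (g : Net d) ∈ NS d :=
  Submodule.Quotient.eq _

/-- Membership in `G_S^∞` concerns some representative; the regularization differs from it by a
negligible net, so it inherits the uniform exponent. -/
theorem exists_growthBound_of_iotaS_mem {d : ℕ} {ρ : 𝓢(E d, ℂ)} {u : OCPrime d}
    (h : iotaS ρ u ∈ GSInfty d) :
    ∃ b : ℕ, ∀ q l, GrowthBound (fun ε => conv u (scaled ρ ε)) q l (-(b : ℝ)) := by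
  obtain ⟨g, ⟨N, ⟨B, hB⟩, hg⟩, hgu⟩ := h
  have hn := GS.mk_eq_mk_iff.mp hgu
  obtain ⟨b, hb⟩ := exists_nat_ge B
  refine ⟨b, fun q l => ?_⟩
  have h1 : GrowthBound (g : Net d) q l (-(b : ℝ)) :=
    (hg q l).mono (neg_le_neg (by exact_mod_cast (hB ⟨(q, l), rfl⟩).trans hb))
  -- Negligibility is used only with `m = 0`: `O(1)` implies `O(ε^{-b})`.
  have h2 := ((hn q l 0).mono (b := -(b : ℝ)) (by simp)).smul (-1)
  have h3 := h1.add h2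
  rwa [neg_one_smul, neg_sub, add_sub_cancel] at h3

theorem exists_bound_regularization {d : ℕ} {ρ : 𝓢(E d, ℂ)} {u : OCPrime d}
    (h : iotaS ρ u ∈ GSInfty d) : ∃ b : ℕ, ∀ q l, ∃ A : ℝ, ∀ k,
      (epsSeq k : ℝ) ^ b * mu q l (conv u (scaled ρ (epsSeq k))) ≤ A := by
  obtain ⟨b, hb⟩ := exists_growthBound_of_iotaS_mem h
  refine ⟨b, fun q l => ?_⟩
  -- Along a sequence with nonvanishing comparison terms, an asymptotic bound holds for every index
  -- after enlarging the constant.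
  obtain ⟨A, -, hA⟩ := Asymptotics.bound_of_isBigO_nat_atTop
    (Asymptotics.IsBigO.comp_tendsto (hb q l) tendsto_epsSeq)
  refine ⟨A, fun k => ?_⟩
  have hpos : (0 : ℝ) < epsSeq k := (epsSeq k).2.1
  have := hA (x := k) (Real.rpow_pos_of_pos hpos _).ne'
  simp only [Function.comp_apply] at this
  rwa [Real.norm_of_nonneg (mu_nonneg _ _ _), Real.norm_of_nonneg (Real.rpow_nonneg hpos.le _),
    Real.rpow_neg hpos.le, Real.rpow_natCast, ← div_eq_mul_inv, le_div_iff₀' (by positivity)] at this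

/-- The heart of the regularity argument: one power of `ε` is gained because the exponent `b` is the
same at derivative order `b + 1 + l` as at order `l`. -/
theorem IsMollifier.exists_cauchy_bound {d : ℕ} {ρ : 𝓢(E d, ℂ)} (hρ : IsMollifier ρ)
    {u : OCPrime d} (h : iotaS ρ u ∈ GSInfty d) (q l : ℕ) : ∃ C : ℝ, ∀ k,
      mu q l (conv u (scaled ρ (epsSeq (k + 1))) - conv u (scaled ρ (epsSeq k))) ≤
        C * (1 / 2 : ℝ) ^ k := by
  obtain ⟨b, hb⟩ := exists_bound_regularization h
  obtain ⟨A, hA⟩ := hb q (b + 1 + l)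
  set K := ∫ y, (1 + ‖y‖) ^ (q + (b + 1)) * ‖ρ y‖
  have hK : 0 ≤ K := integral_nonneg fun y => by positivity
  -- One summand for each regularization error; `2 ^ b` comes from `ε_{k+1} = ε_k / 2`.
  refine ⟨K * A + K * (2 ^ b * A), fun k => ?_⟩
  set w := fun k => conv u (scaled ρ (epsSeq k))
  -- The two double regularizations coincide and cancel.
  have hw : w (k + 1) - w k = (conv (ofSchwartz (w k)) (scaled ρ (epsSeq (k + 1))) - w k) +
      -(conv (ofSchwartz (w (k + 1))) (scaled ρ (epsSeq k)) - w (k + 1)) := by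
    rw [conv_conv_comm]
    abel
  have he : (epsSeq (k + 1) : ℝ) = epsSeq k / 2 := by
    rw [epsSeq_val, epsSeq_val, pow_succ]
    ring
  have hpos : (0 : ℝ) < epsSeq k := (epsSeq k).2.1
  have h1 := hρ.mu_conv_scaled_sub_le q l b (epsSeq (k + 1)) (w k)
  have h2 := hρ.mu_conv_scaled_sub_le q l b (epsSeq k) (w (k + 1))
  have hA1 := hA k
  have hA2 := hA (k + 1)
  have hμ1 := mu_nonneg q (b + 1 + l) (w k)
  change (epsSeq k : ℝ) ^ b * mu q (b + 1 + l) (w k) ≤ A at hA1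
  change (epsSeq (k + 1) : ℝ) ^ b * mu q (b + 1 + l) (w (k + 1)) ≤ A at hA2
  change mu q l (w (k + 1) - w k) ≤ _
  rw [he] at h1
  rw [he, div_pow, div_mul_eq_mul_div, div_le_iff₀ (by positivity)] at hA2
  rw [hw]
  refine (mu_add_le _ _ _ _).trans ?_
  rw [← epsSeq_val, add_mul]
  refine add_le_add (h1.trans ?_) ((mu_neg_le _ _ _).trans (h2.trans ?_))
  · calc K * (epsSeq k / 2 : ℝ) ^ (b + 1) * mu q (b + 1 + l) (w k)
        ≤ K * (epsSeq k : ℝ) ^ (b + 1) * mu q (b + 1 + l) (w k) := by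
          gcongr
          linarith
      _ = K * ((epsSeq k : ℝ) ^ b * mu q (b + 1 + l) (w k)) * epsSeq k := by ring
      _ ≤ K * A * epsSeq k := by gcongr
  · calc K * (epsSeq k : ℝ) ^ (b + 1) * mu q (b + 1 + l) (w (k + 1))
        = K * ((epsSeq k : ℝ) ^ b * mu q (b + 1 + l) (w (k + 1))) * epsSeq k := by ring
      _ ≤ K * (A * 2 ^ b) * epsSeq k := by gcongr
      _ = _ := by ring

theorem tendsto_of_norm_sub_le_geometric {a : ℕ → ℂ} {b : ℂ} {C : ℝ}
    (h : ∀ k, ‖a k - b‖ ≤ C * (1 / 2 : ℝ) ^ k) : Filter.Tendsto a Filter.atTop (𝓝 b) := by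
  rw [tendsto_iff_norm_sub_tendsto_zero]
  refine squeeze_zero (fun _ => norm_nonneg _) h ?_
  simpa using (tendsto_pow_atTop_nhds_zero_of_lt_one (r := (1 / 2 : ℝ)) (by norm_num)
    (by norm_num)).const_mul C

/-- A rapidly decreasing distribution whose class is in `G_S^∞` is a Schwartz function. -/
theorem IsMollifier.exists_eq_coe {d : ℕ} {ρ : 𝓢(E d, ℂ)} (hρ : IsMollifier ρ)
    {u : OCPrime d} (h : iotaS ρ u ∈ GSInfty d) :
    ∃ f : 𝓢(E d, ℂ), u.1 = (f : 𝓢'(E d, ℂ)) := by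
  choose C hC using hρ.exists_cauchy_bound h
  obtain ⟨f, hf⟩ := exists_schwartz_limit (fun k => conv u (scaled ρ (epsSeq k))) C hC
  refine ⟨f, ?_⟩
  ext φ
  -- Against each test function the pairings tend both to `u φ` and to `∫ φ f`.
  obtain ⟨A, hA⟩ := hρ.norm_integral_conv_sub_le u φ
  have h1 : Filter.Tendsto (fun k => ∫ x, φ x * conv u (scaled ρ (epsSeq k)) x) Filter.atTop
      (𝓝 (u.1 φ)) := tendsto_of_norm_sub_le_geometric fun k => hA (epsSeq k)
  have hint (g : 𝓢(E d, ℂ)) : Integrable fun x => φ x * g x :=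
    integrable_mul_schwartz φ.continuous (k := 0) (A := mu 0 0 φ)
      (fun x => by simpa using le_mu (q := 0) (n := 0) le_rfl φ x) g
  have h2 : Filter.Tendsto (fun k => ∫ x, φ x * conv u (scaled ρ (epsSeq k)) x) Filter.atTop
      (𝓝 (∫ x, φ x * f x)) := by
    refine tendsto_of_norm_sub_le_geometric (C := (∫ x, ‖φ x‖) * (2 * C 0 0)) fun k => ?_
    rw [← integral_sub (hint _) (hint _), mul_assoc, ← integral_mul_const]
    refine norm_integral_le_of_norm_le (φ.integrable.norm.mul_const _)
      (Filter.Eventually.of_forall fun x => ?_)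
    rw [← mul_sub, norm_mul]
    exact mul_le_mul_of_nonneg_left (hf k x) (norm_nonneg _)
  rw [tendsto_nhds_unique h1 h2, SchwartzMap.coe_apply]
  rfl

end RapidlyDecreasing

theorem mainTheorem5 (d : ℕ) (ρ : 𝓢(RapidlyDecreasing.E d, ℂ))
    (hρ : RapidlyDecreasing.IsMollifier ρ) :
    -- the identity `ι_S(O_C') ∩ G_S^∞ = σ_S(S)` inside `G_S`
    Set.range (RapidlyDecreasing.iotaS ρ) ∩
        (RapidlyDecreasing.GSInfty d : Set (RapidlyDecreasing.GS d)) =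
      Set.range (RapidlyDecreasing.sigmaS (d := d)) ∧
    -- the same identity inside `O_C'`: `ι_S(u) ∈ G_S^∞` iff `u` is a Schwartz function
    {u : 𝓢'(RapidlyDecreasing.E d, ℂ) | ∃ hu : u ∈ RapidlyDecreasing.OCPrime d,
        RapidlyDecreasing.iotaS ρ ⟨u, hu⟩ ∈ RapidlyDecreasing.GSInfty d} =
      Set.range (fun f : 𝓢(RapidlyDecreasing.E d, ℂ) => (f : 𝓢'(RapidlyDecreasing.E d, ℂ))) := by
  refine ⟨Set.Subset.antisymm ?_ ?_, Set.Subset.antisymm ?_ ?_⟩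
  · rintro _ ⟨⟨u, rfl⟩, h⟩
    obtain ⟨f, hf⟩ := hρ.exists_eq_coe h
    exact ⟨f, by rw [← hρ.iotaS_ofSchwartz, show u = RapidlyDecreasing.ofSchwartz f from Subtype.ext hf]⟩
  · rintro _ ⟨f, rfl⟩
    exact ⟨⟨RapidlyDecreasing.ofSchwartz f, hρ.iotaS_ofSchwartz f⟩,
      RapidlyDecreasing.sigmaS_mem_GSInfty f⟩
  · rintro u ⟨hu, h⟩
    obtain ⟨f, hf⟩ := hρ.exists_eq_coe h
    exact ⟨f, hf.symm⟩
  · rintro _ ⟨f, rfl⟩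
    refine ⟨RapidlyDecreasing.coe_mem_OCPrime f, ?_⟩
    have := RapidlyDecreasing.sigmaS_mem_GSInfty f
    rwa [← hρ.iotaS_ofSchwartz] at this
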